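/- Let $q$ be a prime power. For $g\ge 1$ let $W_q(g)$ be the set of $q$-Weil polynomials of degree $2g$, that is, monic polynomials in $\mathbb{Z}[x]$ of degree $2g$ whose complex roots, counted with multiplicity, are $w_1,\overline{w_1},\dots,w_g,\overline{w_g}$ for some $w_i\in\mathbb{C}$ with $|w_i|=\sqrt q$. Let $$h(x)=x^8+a_1x^7+a_2x^6+a_3x^5+a_4x^4+a_3q\,x^3+a_2q^2x^2+a_1q^3x+q^4$$ with $a_1,a_2,a_3,a_4\in\mathbb{Z}$. Consider the conditions (a) $|a_1|\le 8\sqrt q$; (b*) $6\sqrt q\,|a_1|-20q\le a_2$; (b) $a_2\le \frac38a_1^2+4q$; (c) $-9qa_1-4\sqrt q\,a_2-16q\sqrt q\le a_3\le -9qa_1+4\sqrt q\,a_2+16q\sqrt q$; (d) $\frac12a_1a_2-\frac18a_1^3+qa_1-\frac1{216}(9a_1^2-24a_2+96q)^{3/2}\le a_3\le \frac12a_1a_2-\frac18a_1^3+qa_1+\frac1{216}(9a_1^2-24a_2+96q)^{3/2}$; (e) $2\sqrt q\,|qa_1+a_3|-2qa_2-2q^2\le a_4$; where the quantity between parentheses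 in (d) is non-negative by (b). Put $$u_2=-\frac{3a_1^2}{16}+\frac{a_2}{2}-2q,\qquad u_3=-\frac{a_1^3}{32}+\frac{a_1a_2}{8}+\frac{a_1q}{4}-\frac{a_3}{4},\qquad \Delta=u_3^2+\frac{4u_2^3}{27}.$$ Let $\sqrt\Delta$ be any complex square root of $\Delta$, $\zeta$ any primitive third root of unity and $\omega$ any complex third root of $\frac12(-u_3+\sqrt\Delta)$, and let $S$ be the multiset of the three numbers $$-\zeta^{k}\omega\left(\frac{9u_3}{2}+\frac{3\sqrt\Delta}{2}\right)-\zeta^{-k}\overline{\omega}\left(\frac{9u_3}{2}-\frac{3\sqrt\Delta}{2}\right)+\frac{2u_2^2}{3},\qquad k=0,1,2.$$ 1. If $h\in W_q(4)$, or if (a), (b*), (b), (c), (d) hold, then the elements of $S$ are real numbers. When the elements of $S$ are real, sort them with multiplicity as $\theta_1\le\theta_2\le\theta_3$ and consider (g) $G+\theta_1\le a_4\le G+\theta_2$, where $G=\frac{3}{256}a_1^4-\frac1{16}a_1^2a_2-\frac12qa_1^2+\frac14a_1a_3+2qa_2-2q^2$. 2. $h\in W_q(4)$ if and only if (a), (b*),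 (b), (c), (d), (e) and (g) all hold (so that, in particular, the elements of $S$ are real). 3. If $h\in W_q(4)$, then $h$ has a real root if and only if at least one of the inequalities in (a), (b*), (c), (e) is an equality. 4. $h$ is in $W_q(4)$ and has a real root if and only if one of the following two mutually exclusive cases occurs: (I) $q$ is a square and $h(x)=(x+\sqrt q)^2h_0(x)$ or $h(x)=(x-\sqrt q)^2h_0(x)$ for some $h_0\in W_q(3)$; (II) $q$ is not a square and $h(x)=(x^2-q)^2h_0(x)$ for some $h_0\in W_q(2)$. -/

import Mathlib

open Polynomial

namespace QWeil

/-- The set `W_q(g)` of `q`-Weil polynomials of degree `2g`: monic integer polynomials of positive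
even degree `2g` whose complex roots, counted with multiplicity, are
`w₁, conj w₁, …, w_g, conj w_g` with every `|wᵢ| = √q`. -/
def weilPolys (q g : ℕ) : Set ℤ[X] :=
  {h | 0 < g ∧ h.Monic ∧ h.natDegree = 2 * g ∧
    ∃ w : Fin g → ℂ, (∀ i, ‖w i‖ = Real.sqrt q) ∧
      h.aroots ℂ = Finset.univ.val.map w +
        Finset.univ.val.map (fun i => (starRingEnd ℂ) (w i))}

/-- `x⁸ + a₁x⁷ + a₂x⁶ + a₃x⁵ + a₄x⁴ + a₃q x³ + a₂q² x² + a₁q³ x + q⁴`. -/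
noncomputable def octic (q : ℕ) (a₁ a₂ a₃ a₄ : ℤ) : ℤ[X] :=
  X ^ 8 + C a₁ * X ^ 7 + C a₂ * X ^ 6 + C a₃ * X ^ 5 + C a₄ * X ^ 4
    + C (a₃ * (q : ℤ)) * X ^ 3 + C (a₂ * (q : ℤ) ^ 2) * X ^ 2
    + C (a₁ * (q : ℤ) ^ 3) * X + C ((q : ℤ) ^ 4)

/-- `h` has a real root. -/
def HasRealRoot (h : ℤ[X]) : Prop := ∃ x : ℝ, aeval x h = 0

/-- (a) `|a₁| ≤ 8√q`. -/
def CondA (q a₁ : ℝ) : Prop := |a₁| ≤ 8 * √q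

/-- (b*) `6√q|a₁| - 20q ≤ a₂`. -/
def CondBStar (q a₁ a₂ : ℝ) : Prop := 6 * √q * |a₁| - 20 * q ≤ a₂

/-- (b) `a₂ ≤ (3/8)a₁² + 4q`. -/
def CondB (q a₁ a₂ : ℝ) : Prop := a₂ ≤ 3 / 8 * a₁ ^ 2 + 4 * q

/-- The lower bound for `a₃` in (c). -/
noncomputable def lowerC (q a₁ a₂ : ℝ) : ℝ := -9 * q * a₁ - 4 * √q * a₂ - 16 * q * √q

/-- The upper bound for `a₃` in (c). -/
noncomputable def upperC (q a₁ a₂ : ℝ) : ℝ := -9 * q * a₁ + 4 * √q * a₂ + 16 * q * √q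

/-- (c). -/
def CondC (q a₁ a₂ a₃ : ℝ) : Prop := lowerC q a₁ a₂ ≤ a₃ ∧ a₃ ≤ upperC q a₁ a₂

/-- The quantity raised to the power `3/2` in (d). -/
def radicandD (q a₁ a₂ : ℝ) : ℝ := 9 * a₁ ^ 2 - 24 * a₂ + 96 * q

/-- (d). -/
def CondD (q a₁ a₂ a₃ : ℝ) : Prop :=
  1 / 2 * a₁ * a₂ - 1 / 8 * a₁ ^ 3 + q * a₁
      - 1 / 216 * radicandD q a₁ a₂ ^ (3 / 2 : ℝ) ≤ a₃ ∧
  a₃ ≤ 1 / 2 * a₁ * a₂ - 1 / 8 * a₁ ^ 3 + q * a₁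
      + 1 / 216 * radicandD q a₁ a₂ ^ (3 / 2 : ℝ)

/-- The lower bound for `a₄` in (e). -/
noncomputable def lowerE (q a₁ a₂ a₃ : ℝ) : ℝ :=
  2 * √q * |q * a₁ + a₃| - 2 * q * a₂ - 2 * q ^ 2

/-- (e). -/
def CondE (q a₁ a₂ a₃ a₄ : ℝ) : Prop := lowerE q a₁ a₂ a₃ ≤ a₄

/-- `u₂`. -/
noncomputable def u₂ (q a₁ a₂ : ℝ) : ℝ := -(3 * a₁ ^ 2) / 16 + a₂ / 2 - 2 * q

/-- `u₃`. -/
noncomputable def u₃ (q a₁ a₂ a₃ : ℝ) : ℝ :=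
  -(a₁ ^ 3) / 32 + a₁ * a₂ / 8 + a₁ * q / 4 - a₃ / 4

/-- `Δ = u₃² + 4u₂³/27`. -/
noncomputable def Δ (q a₁ a₂ a₃ : ℝ) : ℝ := u₃ q a₁ a₂ a₃ ^ 2 + 4 * u₂ q a₁ a₂ ^ 3 / 27

/-- The three elements of `S`, indexed by `k = 0, 1, 2`, for a square root `δ` of `Δ`, a primitive
third root of unity `ζ`, and a third root `ω` of `(-u₃ + δ)/2`; here `v₂, v₃` stand for
`u₂, u₃`. -/
noncomputable def cardano (v₂ v₃ : ℝ) (δ ζ ω : ℂ) (k : Fin 3) : ℂ :=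
  -(ζ ^ (k : ℕ) * ω * (9 * (v₃ : ℂ) / 2 + 3 * δ / 2))
    - (ζ ^ (k : ℕ))⁻¹ * (starRingEnd ℂ) ω * (9 * (v₃ : ℂ) / 2 - 3 * δ / 2)
    + 2 * (v₂ : ℂ) ^ 2 / 3

/-- The complex numbers `s 0, s 1, s 2` are all real, and `θ 0 ≤ θ 1 ≤ θ 2` is the
list of them in nondecreasing order, with repetitions. -/
def IsSorting (s : Fin 3 → ℂ) (θ : Fin 3 → ℝ) : Prop :=
  Monotone θ ∧ ∃ σ : Equiv.Perm (Fin 3), ∀ k, (θ k : ℂ) = s (σ k)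

/-- The part of the bounds on `a₄` in (g) that does not involve `S`. -/
noncomputable def baseG (q a₁ a₂ a₃ : ℝ) : ℝ :=
  3 / 256 * a₁ ^ 4 - 1 / 16 * a₁ ^ 2 * a₂ - 1 / 2 * q * a₁ ^ 2 + 1 / 4 * a₁ * a₃
    + 2 * q * a₂ - 2 * q ^ 2

/-- (g), with `θ₁` and `θ₂` the two smallest elements of `S`. -/
def CondG (q a₁ a₂ a₃ a₄ θ₁ θ₂ : ℝ) : Prop :=
  baseG q a₁ a₂ a₃ + θ₁ ≤ a₄ ∧ a₄ ≤ baseG q a₁ a₂ a₃ + θ₂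

/-- At least one of the inequalities in (a), (b*), (c), (e) is an equality. -/
def SomeEquality (q a₁ a₂ a₃ a₄ : ℝ) : Prop :=
  |a₁| = 8 * √q ∨
  6 * √q * |a₁| - 20 * q = a₂ ∨
  (lowerC q a₁ a₂ = a₃ ∨ a₃ = upperC q a₁ a₂) ∨
  lowerE q a₁ a₂ a₃ = a₄

/-- Case (I): `q` is a square (with positive square root `r`) and `h = (x + r)² h₀` or
`h = (x - r)² h₀` with `h₀ ∈ W_q(3)`. -/
def CaseI (q : ℕ) (h : ℤ[X]) : Prop :=
  ∃ r : ℕ, r ^ 2 = q ∧ ∃ h₀ ∈ weilPolys q 3,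
    h = (X + C (r : ℤ)) ^ 2 * h₀ ∨ h = (X - C (r : ℤ)) ^ 2 * h₀

/-- Case (II): `q` is not a square and `h = (x² - q)² h₀` with `h₀ ∈ W_q(2)`. -/
def CaseII (q : ℕ) (h : ℤ[X]) : Prop :=
  ¬ IsSquare q ∧ ∃ h₀ ∈ weilPolys q 2, h = (X ^ 2 - C (q : ℤ)) ^ 2 * h₀

end QWeil

/-!
Since `h` is palindromic, `h(x) = x⁴ f(x + q/x)` for a monic real quartic `f`, and the conjugate
pair `w, conj w` of roots of `h` with `|w| = √q` corresponds to the root `w + conj w` of `f`. Hence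
`h` is a `q`-Weil polynomial exactly when `f` has four real roots, with multiplicity, all in
`[-2√q, 2√q]` (`octic_mem_weilPolys_iff`), and it has a real root exactly when moreover an endpoint
is a root of `f` (`hasRealRoot_octic_iff`).

*Location of the roots.* The Taylor coefficients of `f` at `2√q` are the elementary symmetric
functions of the numbers `2√q - xᵢ`, and similarly at `-2√q`. Conditions (a), (b*), (c), (e) say
that these coefficients, for the third, second, first and zeroth derivative, have the right sign.
For a real-rooted `f` this is equivalent to all `2√q ± xᵢ` being nonnegative
(`roots_bounded_iff`). If no root is an endpoint then all these inequalities are strict, while a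
root at an endpoint turns (e) into an equality (`exists_root_at_endpoint_iff`).

*Real-rootedness.* The shift by `a₁/4` turns `f` into `z⁴ + 2u₂z² - 4u₃z + c` with `c = a₄ - G`,
whose derivative is `4(z³ + u₂z - u₃)`. By Rolle's theorem the cubic is real-rooted if `f` is, and
this is what (b) and (d), that is `Δ ≤ 0`, express. Given sorted critical points `g₁ ≤ g₂ ≤ g₃`, the
quartic is real-rooted if and only if its values there are `≤ 0`, `≥ 0`, `≤ 0`
(`signs_of_real_rooted`, `exists_roots_of_signs`). When `Δ ≤ 0`, Cardano's formula for the `gₖ`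
shows that the elements of `S` are the numbers `-(u₂gₖ² - 3u₃gₖ)` (`exists_roots_of_cardano`), that
is, the values of `c` for which `gₖ` is a root of the quartic. The one for the middle critical point is
the smallest (`IsSortedCritical.middle_max`), so the three sign conditions say that `c` lies between
the two smallest elements of `S`, which is (g).

*Explicit real roots.* A real root of a Weil polynomial is `±√q` and has even multiplicity, because
it is its own conjugate. If `q` is not a square then `√q` is irrational, so both `√q` and `-√q` are
roots (`aeval_octic_neg`). The resulting factor is split off over `ℤ` because it is monic
(`exists_mul_of_aroots`).
-/

open Polynomial

namespace QWeil

/-! ### Weil polynomials as multisets of conjugate pairs -/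

/-- The indexing of the conjugate pairs is replaced by a multiset, to which pairs can be added and
from which they can be removed. -/
theorem mem_weilPolys_iff {q g : ℕ} {h : ℤ[X]} :
    h ∈ weilPolys q g ↔ 0 < g ∧ h.Monic ∧ ∃ M : Multiset ℂ, M.card = g ∧
      (∀ z ∈ M, ‖z‖ = √q) ∧ h.aroots ℂ = M + M.map (starRingEnd ℂ) := by
  constructor
  · rintro ⟨hg, hm, -, w, hw, hr⟩
    refine ⟨hg, hm, Finset.univ.val.map w, by simp, ?_, ?_⟩
    · simpa using hw
    · rw [hr, Multiset.map_map]; rfl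
  · rintro ⟨hg, hm, M, hM, hn, hr⟩
    have hdeg : h.natDegree = 2 * g := by
      have h1 : (h.map (algebraMap ℤ ℂ)).natDegree = h.natDegree := hm.natDegree_map _
      rw [← h1, ← IsAlgClosed.card_roots_eq_natDegree, ← aroots_def, hr]
      simp [hM]; omega
    refine ⟨hg, hm, hdeg, ?_⟩
    induction M using Quotient.inductionOn with
    | _ l =>
      obtain rfl : l.length = g := by simpa using hM
      have hl : Finset.univ.val.map l.get = (l : Multiset ℂ) := by
        rw [Fin.univ_val_map, List.ofFn_get]
      refine ⟨l.get, fun i => hn _ (by simp), ?_⟩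
      rw [hr, show (fun i => (starRingEnd ℂ) (l.get i)) = (starRingEnd ℂ) ∘ l.get from rfl,
        ← Multiset.map_map, hl]
      rfl

theorem map_eq_prod_aroots {h : ℤ[X]} (hm : h.Monic) :
    h.map (algebraMap ℤ ℂ) = ((h.aroots ℂ).map fun z => X - C z).prod := by
  have := (IsAlgClosed.splits (h.map (algebraMap ℤ ℂ))).eq_prod_roots
  rwa [(hm.map _).leadingCoeff, C_1, one_mul] at this

/-- A monic factor whose roots are among those of a Weil polynomial in conjugate pairs can be split
off, and the complementary factor is again a Weil polynomial. -/
theorem exists_mul_of_aroots {q g : ℕ} (hg : 0 < g) {h m : ℤ[X]} (hh : h.Monic) (hm : m.Monic)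
    {M : Multiset ℂ} (hM : M.card = g) (hn : ∀ z ∈ M, ‖z‖ = √q)
    (hr : h.aroots ℂ = m.aroots ℂ + (M + M.map (starRingEnd ℂ))) :
    ∃ h₀ ∈ weilPolys q g, h = m * h₀ := by
  have hdvd : m ∣ h := by
    rw [← map_dvd_map (algebraMap ℤ ℂ) (algebraMap ℤ ℂ).injective_int hm,
      map_eq_prod_aroots hh, map_eq_prod_aroots hm, hr, Multiset.map_add, Multiset.prod_add]
    exact dvd_mul_right _ _
  obtain ⟨h₀, rfl⟩ := hdvd
  have h0m : h₀.Monic := hm.of_mul_monic_left hh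
  refine ⟨h₀, mem_weilPolys_iff.2 ⟨hg, h0m, M, hM, hn, ?_⟩, rfl⟩
  rw [aroots_mul (hh.ne_zero)] at hr
  exact add_left_cancel hr

theorem mul_mem_weilPolys {q g k : ℕ} {h₀ m : ℤ[X]} (hh : h₀ ∈ weilPolys q g) (hm : m.Monic)
    {M : Multiset ℂ} (hM : M.card = k) (hn : ∀ z ∈ M, ‖z‖ = √q)
    (hr : m.aroots ℂ = M + M.map (starRingEnd ℂ)) :
    m * h₀ ∈ weilPolys q (k + g) := by
  obtain ⟨hg, h0m, N, hN, hNn, hNr⟩ := mem_weilPolys_iff.1 hh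
  refine mem_weilPolys_iff.2 ⟨by omega, hm.mul h0m, M + N, by simp [hM, hN], ?_, ?_⟩
  · intro z hz
    rcases Multiset.mem_add.1 hz with hz | hz
    exacts [hn z hz, hNn z hz]
  · rw [aroots_mul (hm.mul h0m).ne_zero, hr, hNr, Multiset.map_add]
    abel

/-! ### The associated quartic -/

theorem octic_monic (q : ℕ) (a₁ a₂ a₃ a₄ : ℤ) : (octic q a₁ a₂ a₃ a₄).Monic := by
  unfold octic; monicity!

/-- `x i` are the four roots, with multiplicity, of `t⁴ + b₁t³ + b₂t² + b₃t + b₄`; the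
factorization is expressed as an identity of real functions. -/
def IsQuarticRoots (b₁ b₂ b₃ b₄ : ℝ) (x : Fin 4 → ℝ) : Prop :=
  ∀ t : ℝ, t ^ 4 + b₁ * t ^ 3 + b₂ * t ^ 2 + b₃ * t + b₄ = ∏ i, (t - x i)

theorem isQuarticRoots_iff {b₁ b₂ b₃ b₄ : ℝ} {x : Fin 4 → ℝ} :
    IsQuarticRoots b₁ b₂ b₃ b₄ x ↔
      b₁ = -(x 0 + x 1 + x 2 + x 3) ∧
      b₂ = x 0 * x 1 + x 0 * x 2 + x 0 * x 3 + x 1 * x 2 + x 1 * x 3 + x 2 * x 3 ∧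
      b₃ = -(x 0 * x 1 * x 2 + x 0 * x 1 * x 3 + x 0 * x 2 * x 3 + x 1 * x 2 * x 3) ∧
      b₄ = x 0 * x 1 * x 2 * x 3 := by
  simp only [IsQuarticRoots, Fin.prod_univ_four]
  constructor
  · intro h
    have h0 := h 0
    have h1 := h 1
    have h2 := h (-1)
    have h3 := h 2
    have h4 := h (-2)
    refine ⟨?_, ?_, ?_, ?_⟩ <;> linarith
  · rintro ⟨rfl, rfl, rfl, rfl⟩ t
    ring

/-- The palindromic expansion: `X⁴ f(X + q/X)` is the product of the `X² - xᵢX + q`, where `f` is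
the monic quartic with roots `xᵢ`. -/
theorem octic_map_eq_prod_iff {q : ℕ} {a₁ a₂ a₃ a₄ : ℤ} {x : Fin 4 → ℝ} :
    (octic q a₁ a₂ a₃ a₄).map (algebraMap ℤ ℂ) =
        ∏ i, (X ^ 2 - C (x i : ℂ) * X + C (q : ℂ)) ↔
      IsQuarticRoots a₁ (a₂ - 4 * q) (a₃ - 3 * q * a₁) (a₄ - 2 * q * a₂ + 2 * q ^ 2) x := by
  rw [isQuarticRoots_iff]
  set e₁ := x 0 + x 1 + x 2 + x 3 with he₁
  set e₂ := x 0 * x 1 + x 0 * x 2 + x 0 * x 3 + x 1 * x 2 + x 1 * x 3 + x 2 * x 3 with he₂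
  set e₃ := x 0 * x 1 * x 2 + x 0 * x 1 * x 3 + x 0 * x 2 * x 3 + x 1 * x 2 * x 3 with he₃
  set e₄ := x 0 * x 1 * x 2 * x 3 with he₄
  have hprod : ∏ i, (X ^ 2 - C (x i : ℂ) * X + C (q : ℂ)) =
      X ^ 8 + C (((-e₁ : ℝ)) : ℂ) * X ^ 7 + C ((e₂ + 4 * q : ℝ) : ℂ) * X ^ 6
      + C ((-e₃ - 3 * q * e₁ : ℝ) : ℂ) * X ^ 5
      + C ((e₄ + 2 * q * e₂ + 6 * q ^ 2 : ℝ) : ℂ) * X ^ 4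
      + C (((-e₃ - 3 * q * e₁) * q : ℝ) : ℂ) * X ^ 3
      + C (((e₂ + 4 * q) * q ^ 2 : ℝ) : ℂ) * X ^ 2
      + C (((-e₁) * q ^ 3 : ℝ) : ℂ) * X + C ((q : ℂ) ^ 4) := by
    rw [Fin.prod_univ_four, he₁, he₂, he₃, he₄]
    push_cast
    simp only [map_add, map_mul, map_neg, map_sub, map_pow, map_ofNat, map_natCast]
    ring
  have hoct : (octic q a₁ a₂ a₃ a₄).map (algebraMap ℤ ℂ) =
      X ^ 8 + C ((a₁ : ℝ) : ℂ) * X ^ 7 + C ((a₂ : ℝ) : ℂ) * X ^ 6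
      + C ((a₃ : ℝ) : ℂ) * X ^ 5
      + C ((a₄ : ℝ) : ℂ) * X ^ 4
      + C ((a₃ * q : ℝ) : ℂ) * X ^ 3
      + C ((a₂ * q ^ 2 : ℝ) : ℂ) * X ^ 2
      + C ((a₁ * q ^ 3 : ℝ) : ℂ) * X + C ((q : ℂ) ^ 4) := by
    simp [octic]
  rw [hprod, hoct]
  constructor
  · intro h
    have h7 := congrArg (fun P => coeff P 7) h
    have h6 := congrArg (fun P => coeff P 6) h
    have h5 := congrArg (fun P => coeff P 5) h
    have h4 := congrArg (fun P => coeff P 4) h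
    simp only [coeff_add, coeff_C_mul, coeff_X_pow, coeff_X, coeff_C] at h7 h6 h5 h4
    norm_num at h7 h6 h5 h4
    norm_cast at h7 h6 h5 h4
    push_cast at h7 h6 h5 h4
    refine ⟨h7, by linarith, ?_, ?_⟩
    · rw [h5, h7]; ring
    · rw [h4, h6]; ring
  · rintro ⟨h1, h2, h3, h4⟩
    have h2' : (a₂ : ℝ) = e₂ + 4 * q := by linarith
    have h3' : (a₃ : ℝ) = -e₃ - 3 * q * e₁ := by rw [h1] at h3; linarith
    have h4' : (a₄ : ℝ) = e₄ + 2 * q * e₂ + 6 * q ^ 2 := by rw [h2'] at h4; linarith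
    rw [h1, h2', h3', h4']

/-- The roots of the quartic are `w + conj w = 2 Re w` for the conjugate pairs of roots of `h`. -/
theorem octic_mem_weilPolys_iff {q : ℕ} {a₁ a₂ a₃ a₄ : ℤ} :
    octic q a₁ a₂ a₃ a₄ ∈ weilPolys q 4 ↔ ∃ x : Fin 4 → ℝ,
      IsQuarticRoots a₁ (a₂ - 4 * q) (a₃ - 3 * q * a₁) (a₄ - 2 * q * a₂ + 2 * q ^ 2) x ∧
      ∀ i, |x i| ≤ 2 * √q := by
  have hq : √(q : ℝ) ^ 2 = q := Real.sq_sqrt (Nat.cast_nonneg q)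
  have hfac : ∀ {w : ℂ} {y : ℝ}, ‖w‖ = √q → y = 2 * w.re →
      (X - C w) * (X - C ((starRingEnd ℂ) w)) = X ^ 2 - C (y : ℂ) * X + C (q : ℂ) := by
    rintro w _ hw rfl
    have h1 : w * (starRingEnd ℂ) w = (q : ℂ) := by
      rw [Complex.mul_conj, Complex.normSq_eq_norm_sq, hw, hq]; simp
    have h2 : w + (starRingEnd ℂ) w = ((2 * w.re : ℝ) : ℂ) := by
      rw [Complex.add_conj]
    rw [← h1, ← h2, C_add, C_mul]
    ring
  constructor
  · rintro ⟨-, hm, -, w, hw, hr⟩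
    refine ⟨fun i => 2 * (w i).re, octic_map_eq_prod_iff.1 ?_, fun i => ?_⟩
    · rw [map_eq_prod_aroots hm, hr, Multiset.map_add, Multiset.prod_add, Multiset.map_map,
        Multiset.map_map]
      change (∏ i, (X - C (w i))) * (∏ i, (X - C ((starRingEnd ℂ) (w i)))) = _
      rw [← Finset.prod_mul_distrib]
      exact Finset.prod_congr rfl fun i _ => hfac (hw i) rfl
    · rw [abs_mul, abs_two, ← hw i]
      gcongr
      exact Complex.abs_re_le_norm _
  · rintro ⟨x, hx, hb⟩
    refine mem_weilPolys_iff.2 ⟨by norm_num, octic_monic .., ?_⟩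
    -- The root of `w² - xᵢw + q` in the closed upper half plane.
    set w : Fin 4 → ℂ := fun i => ⟨x i / 2, √(q - (x i / 2) ^ 2)⟩ with hwdef
    have hw : ∀ i, ‖w i‖ = √q := fun i => by
      have h1 : (x i / 2) ^ 2 ≤ q := by
        rw [← hq, sq_le_sq, abs_of_nonneg (Real.sqrt_nonneg _), abs_div, abs_two]
        linarith [hb i]
      rw [Complex.norm_def, Complex.normSq_mk, Real.mul_self_sqrt (by linarith)]
      congr 1; ring
    refine ⟨Finset.univ.val.map w, by simp, ?_, ?_⟩
    · intro z hz
      obtain ⟨i, -, rfl⟩ := Multiset.mem_map.1 hz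
      exact hw i
    rw [← roots_multiset_prod_X_sub_C (_ + _), aroots_def, octic_map_eq_prod_iff.2 hx,
      Multiset.map_add, Multiset.prod_add, Multiset.map_map, Multiset.map_map, Multiset.map_map]
    change _ = ((∏ i, (X - C (w i))) * (∏ i, (X - C ((starRingEnd ℂ) (w i))))).roots
    rw [← Finset.prod_mul_distrib]
    congr 1
    exact Finset.prod_congr rfl fun i _ => (hfac (hw i) (by simp [hwdef]; ring)).symm

theorem aeval_octic {q : ℕ} {a₁ a₂ a₃ a₄ : ℤ} {x : Fin 4 → ℝ}
    (hx : IsQuarticRoots a₁ (a₂ - 4 * q) (a₃ - 3 * q * a₁) (a₄ - 2 * q * a₂ + 2 * q ^ 2) x)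
    (y : ℝ) : aeval y (octic q a₁ a₂ a₃ a₄) = ∏ i, (y ^ 2 - x i * y + q) := by
  have h := congrArg (eval (y : ℂ)) (octic_map_eq_prod_iff.2 hx)
  rw [eval_map_algebraMap, eval_prod] at h
  apply Complex.ofReal_injective
  simpa [Complex.ofReal_prod, octic] using h

theorem hasRealRoot_octic_iff {q : ℕ} {a₁ a₂ a₃ a₄ : ℤ} {x : Fin 4 → ℝ}
    (hx : IsQuarticRoots a₁ (a₂ - 4 * q) (a₃ - 3 * q * a₁) (a₄ - 2 * q * a₂ + 2 * q ^ 2) x)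
    (hb : ∀ i, |x i| ≤ 2 * √q) :
    HasRealRoot (octic q a₁ a₂ a₃ a₄) ↔ ∃ i, |x i| = 2 * √q := by
  have hq : √(q : ℝ) ^ 2 = q := Real.sq_sqrt (Nat.cast_nonneg q)
  simp only [HasRealRoot, aeval_octic hx, Finset.prod_eq_zero_iff, Finset.mem_univ, true_and]
  constructor
  · rintro ⟨y, i, hy⟩
    refine ⟨i, le_antisymm (hb i) ?_⟩
    -- A real root of `y² - xᵢy + q` makes the discriminant `xᵢ² - 4q` nonnegative.
    apply le_of_sq_le_sq ?_ (abs_nonneg _)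
    rw [sq_abs]
    nlinarith [sq_nonneg (2 * y - x i)]
  · rintro ⟨i, hi⟩
    have : x i ^ 2 = 4 * q := by rw [← sq_abs, hi, mul_pow, hq]; norm_num
    exact ⟨x i / 2, i, by linarith⟩

/-! ### Signs of elementary symmetric functions -/

/-- All terms of the polynomial `∏ (t - xᵢ)` are nonnegative for `t < 0`, and the leading one is
positive. -/
theorem nonneg_of_esymm_nonneg {x : Fin 4 → ℝ}
    (h₁ : 0 ≤ x 0 + x 1 + x 2 + x 3)
    (h₂ : 0 ≤ x 0 * x 1 + x 0 * x 2 + x 0 * x 3 + x 1 * x 2 + x 1 * x 3 + x 2 * x 3)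
    (h₃ : 0 ≤ x 0 * x 1 * x 2 + x 0 * x 1 * x 3 + x 0 * x 2 * x 3 + x 1 * x 2 * x 3)
    (h₄ : 0 ≤ x 0 * x 1 * x 2 * x 3) (i : Fin 4) : 0 ≤ x i := by
  by_contra! hneg
  have key : (x i - x 0) * (x i - x 1) * (x i - x 2) * (x i - x 3) = 0 := by
    fin_cases i <;> simp
  set t := x i
  have e1 := mul_nonneg h₁ (pow_nonneg (neg_nonneg.2 hneg.le) 3)
  have e2 := mul_nonneg h₂ (pow_nonneg (neg_nonneg.2 hneg.le) 2)
  have e3 := mul_nonneg h₃ (neg_nonneg.2 hneg.le)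
  have e0 : 0 < (-t) ^ 4 := pow_pos (neg_pos.2 hneg) 4
  nlinarith

theorem esymm_nonneg {x : Fin 4 → ℝ} (h : ∀ i, 0 ≤ x i) :
    0 ≤ x 0 + x 1 + x 2 + x 3 ∧
    0 ≤ x 0 * x 1 + x 0 * x 2 + x 0 * x 3 + x 1 * x 2 + x 1 * x 3 + x 2 * x 3 ∧
    0 ≤ x 0 * x 1 * x 2 + x 0 * x 1 * x 3 + x 0 * x 2 * x 3 + x 1 * x 2 * x 3 ∧
    0 ≤ x 0 * x 1 * x 2 * x 3 := by
  have h0 := h 0; have h1 := h 1; have h2 := h 2; have h3 := h 3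
  refine ⟨?_, ?_, ?_, ?_⟩ <;> positivity

theorem esymm_pos {x : Fin 4 → ℝ} (h : ∀ i, 0 < x i) :
    0 < x 0 + x 1 + x 2 + x 3 ∧
    0 < x 0 * x 1 + x 0 * x 2 + x 0 * x 3 + x 1 * x 2 + x 1 * x 3 + x 2 * x 3 ∧
    0 < x 0 * x 1 * x 2 + x 0 * x 1 * x 3 + x 0 * x 2 * x 3 + x 1 * x 2 * x 3 ∧
    0 < x 0 * x 1 * x 2 * x 3 := by
  have h0 := h 0; have h1 := h 1; have h2 := h 2; have h3 := h 3
  refine ⟨?_, ?_, ?_, ?_⟩ <;> positivity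

/-! ### Real-rooted depressed quartics and their critical points -/

/-- `z⁴ + 2pz² + 4rz + c`, with derivative `4(z³ + pz + r)`. -/
def depressed (p r c z : ℝ) : ℝ := z ^ 4 + 2 * p * z ^ 2 + 4 * r * z + c

theorem exists_ge_depressed_eq_zero {p r c g : ℝ} (h : depressed p r c g ≤ 0) :
    ∃ z, g ≤ z ∧ depressed p r c z = 0 := by
  set M := 1 + 2 * |p| + 4 * |r| + |c| + |g| with hM
  have hp := abs_nonneg p
  have hr := abs_nonneg r
  have hc := abs_nonneg c
  have hg := abs_nonneg g
  have hgM : g ≤ M := by linarith [le_abs_self g]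
  have hM1 : 1 ≤ M := by linarith
  have hpos : 0 ≤ depressed p r c M := by
    unfold depressed
    have h1 : -|p| * M ^ 2 ≤ p * M ^ 2 := by gcongr; exact neg_abs_le p
    have h2 : -|r| * M ^ 2 ≤ r * M := by
      have : -|r| * M ≤ r * M := by gcongr; exact neg_abs_le r
      nlinarith [mul_nonneg hr (mul_nonneg (by linarith : (0:ℝ) ≤ M) (by linarith : 0 ≤ M - 1))]
    have h3 : -|c| * M ^ 2 ≤ c := by
      have := neg_abs_le c
      nlinarith [mul_nonneg hc (by nlinarith : 0 ≤ M ^ 2 - 1)]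
    have h4 : (2 * |p| + 4 * |r| + |c|) * M ^ 2 ≤ M ^ 4 := by
      have : (2 * |p| + 4 * |r| + |c|) ≤ M ^ 2 := by nlinarith
      calc _ ≤ M ^ 2 * M ^ 2 := by gcongr
        _ = M ^ 4 := by ring
    linarith
  have hcont : ContinuousOn (depressed p r c) (Set.Icc g M) := by
    unfold depressed; fun_prop
  obtain ⟨z, hz, hz0⟩ := intermediate_value_Icc hgM hcont ⟨h, hpos⟩
  exact ⟨z, hz.1, hz0⟩

theorem exists_le_depressed_eq_zero {p r c g : ℝ} (h : depressed p r c g ≤ 0) :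
    ∃ z, z ≤ g ∧ depressed p r c z = 0 := by
  have h' : depressed p (-r) c (-g) ≤ 0 := by
    unfold depressed at *; convert h using 1; ring
  obtain ⟨z, hz, hz0⟩ := exists_ge_depressed_eq_zero h'
  refine ⟨-z, by linarith, ?_⟩
  rw [← hz0]; unfold depressed; ring

theorem exists_roots_of_nonneg_disc {b c : ℝ} (h : 0 ≤ b ^ 2 - 4 * c) :
    ∃ u v : ℝ, ∀ z, z ^ 2 + b * z + c = (z - u) * (z - v) := by
  refine ⟨(-b + √(b ^ 2 - 4 * c)) / 2, (-b - √(b ^ 2 - 4 * c)) / 2, fun z => ?_⟩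
  have := Real.sq_sqrt h
  linear_combination this / 4

theorem exists_roots_of_nonpos {b c g : ℝ} (h : g ^ 2 + b * g + c ≤ 0) :
    ∃ u v : ℝ, ∀ z, z ^ 2 + b * z + c = (z - u) * (z - v) :=
  exists_roots_of_nonneg_disc (by nlinarith [sq_nonneg (2 * g + b)])

/-- The roots of the derivative of the depressed quartic, in increasing order. -/
structure IsSortedCritical (p r g₁ g₂ g₃ : ℝ) : Prop where
  le₁₂ : g₁ ≤ g₂
  le₂₃ : g₂ ≤ g₃
  sum : g₁ + g₂ + g₃ = 0
  esymm₂ : g₁ * g₂ + g₁ * g₃ + g₂ * g₃ = p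
  prod : g₁ * g₂ * g₃ = -r

/-- The intermediate value theorem gives a root below `g₁` and one above `g₃`; the quadratic
cofactor takes a nonpositive value at `g₂`, so it is real-rooted as well. -/
theorem exists_roots_of_signs {p r c g₁ g₂ g₃ : ℝ} (hg : IsSortedCritical p r g₁ g₂ g₃)
    (h₁ : depressed p r c g₁ ≤ 0) (h₂ : 0 ≤ depressed p r c g₂)
    (h₃ : depressed p r c g₃ ≤ 0) :
    ∃ z : Fin 4 → ℝ, ∀ t, depressed p r c t = ∏ i, (t - z i) := by
  obtain ⟨h12, h23, hs, he, hp⟩ := hg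
  obtain ⟨x, hx, hx0⟩ := exists_le_depressed_eq_zero h₁
  obtain ⟨y, hy, hy0⟩ := exists_ge_depressed_eq_zero h₃
  rcases (hx.trans (h12.trans (h23.trans hy))).lt_or_eq with hlt | heq
  · -- Divide by `(t - x) (t - y)`, where `x ≤ g₁` and `g₃ ≤ y` are the outer roots.
    set b := x + y with hb
    set d := x ^ 2 + x * y + y ^ 2 + 2 * p with hd
    have hr : 4 * r = -(x ^ 3 + x ^ 2 * y + x * y ^ 2 + y ^ 3 + 2 * p * (x + y)) := by
      have : (y - x) * (4 * r + (x ^ 3 + x ^ 2 * y + x * y ^ 2 + y ^ 3 + 2 * p * (x + y))) = 0 := by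
        unfold depressed at hx0 hy0; linear_combination hy0 - hx0
      rcases mul_eq_zero.1 this with h | h <;> linarith
    have hfac : ∀ t, depressed p r c t = (t - x) * (t - y) * (t ^ 2 + b * t + d) := fun t => by
      have hc : c = -(x ^ 4 + 2 * p * x ^ 2 + 4 * r * x) := by
        unfold depressed at hx0; linarith
      unfold depressed
      rw [hc, hr, hb, hd]; ring
    have hm : g₂ ^ 2 + b * g₂ + d ≤ 0 := by
      by_contra! hm
      have hle : (g₂ - x) * (g₂ - y) ≤ 0 :=
        mul_nonpos_of_nonneg_of_nonpos (by linarith) (by linarith)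
      have h0 : (g₂ - x) * (g₂ - y) = 0 := by
        rw [hfac] at h₂
        nlinarith
      -- At an outer root the vanishing of the derivative forces the quadratic factor to vanish.
      have hder : (g₂ - y + (g₂ - x)) * (g₂ ^ 2 + b * g₂ + d)
          + (g₂ - x) * (g₂ - y) * (2 * g₂ + b) = 0 := by
        have hcrit : g₂ ^ 3 + p * g₂ + r = 0 := by
          linear_combination g₂ ^ 2 * hs - g₂ * he + hp
        rw [hb, hd]; linear_combination 4 * hcrit - hr
      rw [h0, zero_mul, add_zero] at hder
      rcases mul_eq_zero.1 hder with h | h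
      · rcases mul_eq_zero.1 h0 with h' | h' <;> linarith
      · linarith
    obtain ⟨u, v, huv⟩ := exists_roots_of_nonpos hm
    refine ⟨![x, y, u, v], fun t => ?_⟩
    rw [hfac, huv, Fin.prod_univ_four]
    simp [mul_assoc]
  · -- All critical points coincide, so the quartic is `t⁴ + c` with `c = 0`.
    obtain rfl : g₁ = 0 := by linarith
    obtain rfl : g₂ = 0 := by linarith
    obtain rfl : g₃ = 0 := by linarith
    refine ⟨0, fun t => ?_⟩
    have : c = 0 := by unfold depressed at h₁ h₂; linarith
    rw [Fin.prod_univ_four]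
    unfold depressed
    rw [this, ← he, show r = 0 by linarith]
    simp; ring

theorem exists_sorted_roots {p r c : ℝ} {z : Fin 4 → ℝ}
    (hz : ∀ t, depressed p r c t = ∏ i, (t - z i)) :
    ∃ x₁ x₂ x₃ x₄ : ℝ, x₁ ≤ x₂ ∧ x₂ ≤ x₃ ∧ x₃ ≤ x₄ ∧
      ∀ t, depressed p r c t = (t - x₁) * (t - x₂) * (t - x₃) * (t - x₄) := by
  have hm := Tuple.monotone_sort z
  refine ⟨_, _, _, _, hm (show (0 : Fin 4) ≤ 1 by decide), hm (show (1 : Fin 4) ≤ 2 by decide),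
    hm (show (2 : Fin 4) ≤ 3 by decide), fun t => ?_⟩
  rw [hz, ← Equiv.prod_comp (Tuple.sort z), Fin.prod_univ_four]
  rfl

theorem depressed_vieta {p r c x₁ x₂ x₃ x₄ : ℝ}
    (h : ∀ t, depressed p r c t = (t - x₁) * (t - x₂) * (t - x₃) * (t - x₄)) :
    x₁ + x₂ + x₃ + x₄ = 0 ∧
    x₁ * x₂ + x₁ * x₃ + x₁ * x₄ + x₂ * x₃ + x₂ * x₄ + x₃ * x₄ = 2 * p ∧
    x₁ * x₂ * x₃ + x₁ * x₂ * x₄ + x₁ * x₃ * x₄ + x₂ * x₃ * x₄ = -(4 * r) := by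
  unfold depressed at h
  have h0 := h 0
  have h1 := h 1
  have h2 := h (-1)
  have h3 := h 2
  have h4 := h (-2)
  refine ⟨?_, ?_, ?_⟩ <;> linarith

/-- A consequence of Rolle's theorem with multiplicities; `t³ + pt + r` is a quarter of the
derivative. -/
theorem derivative_real_rooted {p r c : ℝ} {z : Fin 4 → ℝ}
    (hz : ∀ t, depressed p r c t = ∏ i, (t - z i)) :
    ∃ u v w : ℝ, ∀ t, t ^ 3 + p * t + r = (t - u) * (t - v) * (t - w) := by
  set P : ℝ[X] := X ^ 4 + C (2 * p) * X ^ 2 + C (4 * r) * X + C c with hP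
  have hPz : P = ∏ i, (X - C (z i)) := by
    apply Polynomial.funext
    intro t
    rw [eval_prod]
    simpa [hP, depressed] using hz t
  have hroots : P.roots.card = 4 := by
    rw [hPz]
    have := roots_multiset_prod_X_sub_C (Finset.univ.val.map z)
    rw [Multiset.map_map] at this
    change (∏ i, (X - C (z i))).roots = _ at this
    rw [this]; simp
  have hD : derivative P = C 4 * (X ^ 3 + C p * X + C r) := by
    have c2 : C (2 : ℝ) = 2 := map_ofNat C 2
    have c4 : C (4 : ℝ) = 4 := map_ofNat C 4
    rw [hP, C_mul, C_mul, c2, c4]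
    simp only [derivative_add, derivative_X_pow, derivative_X, derivative_C, derivative_mul,
      derivative_ofNat, Nat.cast_ofNat, c2, c4]
    ring
  have hle := card_roots_le_derivative P
  rw [hroots, hD, roots_C_mul _ (by norm_num)] at hle
  set Q : ℝ[X] := X ^ 3 + C p * X + C r with hQ
  have hQm : Q.Monic := by rw [hQ]; monicity!
  have hQd : Q.natDegree = 3 := by rw [hQ]; compute_degree!
  have hcard : Q.roots.card = 3 := le_antisymm (hQd ▸ card_roots' Q) (by omega)
  obtain ⟨u, v, w, huvw⟩ := Multiset.card_eq_three.1 hcard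
  refine ⟨u, v, w, fun t => ?_⟩
  have := prod_multiset_X_sub_C_of_monic_of_roots_card_eq hQm (hcard.trans hQd.symm)
  rw [huvw] at this
  have := congrArg (eval t) this
  simp [hQ] at this
  linarith

/-- `-27 (r² + 4p³/27)` is the discriminant of `t³ + pt + r`. -/
theorem disc_of_real_rooted {p r c : ℝ} {z : Fin 4 → ℝ}
    (hz : ∀ t, depressed p r c t = ∏ i, (t - z i)) :
    p ≤ 0 ∧ r ^ 2 + 4 * p ^ 3 / 27 ≤ 0 := by
  obtain ⟨u, v, w, h⟩ := derivative_real_rooted hz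
  have h0 := h 0
  have h1 := h 1
  have h2 := h (-1)
  have h3 := h 2
  have hw : w = -u - v := by linarith
  have hp : p = u * v + u * w + v * w := by linarith
  have hr : r = -(u * v * w) := by linarith
  subst hw
  rw [hp, hr]
  constructor
  · nlinarith [sq_nonneg (u + v), sq_nonneg (u - v), sq_nonneg u, sq_nonneg v]
  · -- The square of the product of the differences of the roots `u`, `v`, `-u - v`.
    have := sq_nonneg ((u - v) * (2 * u + v) * (u + 2 * v))
    nlinarith

/-- The critical points interlace the roots. -/
theorem signs_of_real_rooted {p r c g₁ g₂ g₃ : ℝ} (hg : IsSortedCritical p r g₁ g₂ g₃)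
    {z : Fin 4 → ℝ} (hz : ∀ t, depressed p r c t = ∏ i, (t - z i)) :
    depressed p r c g₁ ≤ 0 ∧ 0 ≤ depressed p r c g₂ ∧ depressed p r c g₃ ≤ 0 := by
  obtain ⟨h12, h23, hs, he, hp⟩ := hg
  obtain ⟨x₁, x₂, x₃, x₄, k12, k23, k34, hx⟩ := exists_sorted_roots hz
  obtain ⟨v1, v2, v3⟩ := depressed_vieta hx
  -- Two expressions for the derivative, divided by four.
  have hD : ∀ t, 4 * ((t - g₁) * (t - g₂) * (t - g₃)) =
      (t - x₂) * (t - x₃) * (t - x₄) + (t - x₁) * (t - x₃) * (t - x₄)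
      + (t - x₁) * (t - x₂) * (t - x₄) + (t - x₁) * (t - x₂) * (t - x₃) := fun t => by
    linear_combination -4 * t ^ 2 * hs + 4 * t * he - 4 * hp + 3 * t ^ 2 * v1 - 2 * t * v2 + v3
  have hD2 := hD x₂
  have hD3 := hD x₃
  have a1 : x₁ ≤ g₁ := by
    by_contra! hlt
    have : (g₁ - x₂) * (g₁ - x₃) * (g₁ - x₄) + (g₁ - x₁) * (g₁ - x₃) * (g₁ - x₄)
      + (g₁ - x₁) * (g₁ - x₂) * (g₁ - x₄) + (g₁ - x₁) * (g₁ - x₂) * (g₁ - x₃) = 0 := by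
      rw [← hD]; ring
    have b1 : 0 < x₁ - g₁ := by linarith
    have b2 : 0 < x₂ - g₁ := by linarith
    have b3 : 0 < x₃ - g₁ := by linarith
    have b4 : 0 < x₄ - g₁ := by linarith
    have : 0 < (x₂ - g₁) * (x₃ - g₁) * (x₄ - g₁) + (x₁ - g₁) * (x₃ - g₁) * (x₄ - g₁)
      + (x₁ - g₁) * (x₂ - g₁) * (x₄ - g₁) + (x₁ - g₁) * (x₂ - g₁) * (x₃ - g₁) := by positivity
    linarith
  have a4 : g₃ ≤ x₄ := by
    by_contra! hlt
    have : (g₃ - x₂) * (g₃ - x₃) * (g₃ - x₄) + (g₃ - x₁) * (g₃ - x₃) * (g₃ - x₄)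
      + (g₃ - x₁) * (g₃ - x₂) * (g₃ - x₄) + (g₃ - x₁) * (g₃ - x₂) * (g₃ - x₃) = 0 := by
      rw [← hD]; ring
    have b1 : 0 < g₃ - x₁ := by linarith
    have b2 : 0 < g₃ - x₂ := by linarith
    have b3 : 0 < g₃ - x₃ := by linarith
    have b4 : 0 < g₃ - x₄ := by linarith
    have : 0 < (g₃ - x₂) * (g₃ - x₃) * (g₃ - x₄) + (g₃ - x₁) * (g₃ - x₃) * (g₃ - x₄)
      + (g₃ - x₁) * (g₃ - x₂) * (g₃ - x₄) + (g₃ - x₁) * (g₃ - x₂) * (g₃ - x₃) := by positivity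
    linarith
  have s2 : 0 ≤ (x₂ - g₁) * (x₂ - g₂) * (x₂ - g₃) := by
    have := mul_nonneg (mul_nonneg (sub_nonneg.2 k12) (sub_nonneg.2 k23))
      (sub_nonneg.2 (k23.trans k34))
    nlinarith
  have s3 : (x₃ - g₁) * (x₃ - g₂) * (x₃ - g₃) ≤ 0 := by
    have := mul_nonneg (mul_nonneg (sub_nonneg.2 (k12.trans k23)) (sub_nonneg.2 k23))
      (sub_nonneg.2 k34)
    nlinarith
  have a12 : g₁ ≤ x₂ := by
    by_contra! hlt
    have := mul_pos (mul_pos (sub_pos.2 hlt) (sub_pos.2 (hlt.trans_le h12)))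
      (sub_pos.2 (hlt.trans_le (h12.trans h23)))
    linarith
  have a33 : x₃ ≤ g₃ := by
    by_contra! hlt
    have := mul_pos (mul_pos (sub_pos.2 ((h12.trans h23).trans_lt hlt))
      (sub_pos.2 (h23.trans_lt hlt))) (sub_pos.2 hlt)
    linarith
  -- If `g₂` lay outside `[x₂, x₃]`, then `x₂ = x₃` would be an outer critical point, where the
  -- second derivative is positive; but it is nonpositive at a double root between `x₁` and `x₄`.
  have a22 : x₂ ≤ g₂ := by
    by_contra! hlt
    have hge : g₃ ≤ x₂ := by
      by_contra! hlt'
      have := mul_pos (mul_pos (sub_pos.2 (h12.trans_lt hlt)) (sub_pos.2 hlt)) (sub_pos.2 hlt')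
      linarith
    obtain rfl : x₂ = x₃ := by linarith
    obtain rfl : x₂ = g₃ := by linarith
    have hDD : 4 * ((x₂ - g₁) * (x₂ - g₂)) = 2 * (x₂ - x₁) * (x₂ - x₄) := by
      linear_combination (-8 * x₂) * hs + 4 * he + 6 * x₂ * v1 - 2 * v2
    have := mul_pos (sub_pos.2 (h12.trans_lt hlt)) (sub_pos.2 hlt)
    nlinarith [mul_nonneg (sub_nonneg.2 k12) (sub_nonneg.2 k34)]
  have a23 : g₂ ≤ x₃ := by
    by_contra! hlt
    have hge : x₃ ≤ g₁ := by
      by_contra! hlt'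
      have := mul_pos (mul_pos (sub_pos.2 hlt') (sub_pos.2 hlt)) (sub_pos.2 (hlt.trans_le h23))
      linarith
    obtain rfl : x₃ = x₂ := by linarith
    obtain rfl : x₃ = g₁ := by linarith
    have hDD : 4 * ((x₃ - g₂) * (x₃ - g₃)) = 2 * (x₃ - x₁) * (x₃ - x₄) := by
      linear_combination (-8 * x₃) * hs + 4 * he + 6 * x₃ * v1 - 2 * v2
    have := mul_pos (sub_pos.2 hlt) (sub_pos.2 (hlt.trans_le h23))
    nlinarith [mul_nonneg (sub_nonneg.2 k12) (sub_nonneg.2 k34)]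
  rw [hx, hx, hx]
  refine ⟨?_, ?_, ?_⟩
  · have := mul_nonneg (mul_nonneg (mul_nonneg (sub_nonneg.2 a1) (sub_nonneg.2 a12))
      (sub_nonneg.2 (a12.trans k23))) (sub_nonneg.2 (a12.trans (k23.trans k34)))
    linarith
  · have := mul_nonneg (mul_nonneg (mul_nonneg (sub_nonneg.2 (k12.trans a22)) (sub_nonneg.2 a22))
      (sub_nonneg.2 a23)) (sub_nonneg.2 (a23.trans k34))
    linarith
  · have := mul_nonneg (mul_nonneg (mul_nonneg (sub_nonneg.2 (k12.trans (k23.trans a33)))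
      (sub_nonneg.2 (k23.trans a33))) (sub_nonneg.2 a33)) (sub_nonneg.2 a4)
    linarith

/-! ### Cardano's formula and the multiset `S` -/

/-- When `Δ ≤ 0`, the real roots of `t³ + pt - v` are `gₖ = -(ζᵏω + conj (ζᵏω))`, and the elements
of `S` are `-(p gₖ² - 3v gₖ)`. -/
theorem exists_roots_of_cardano {p v : ℝ} {δ ζ ω : ℂ}
    (hδ : δ ^ 2 = ((v ^ 2 + 4 * p ^ 3 / 27 : ℝ) : ℂ))
    (hneg : v ^ 2 + 4 * p ^ 3 / 27 ≤ 0) (hζ : IsPrimitiveRoot ζ 3)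
    (hω : ω ^ 3 = (-(v : ℂ) + δ) / 2) :
    ∃ g : Fin 3 → ℝ, (∀ k, cardano p v δ ζ ω k = ((-(p * g k ^ 2 - 3 * v * g k) : ℝ) : ℂ)) ∧
      ∀ t : ℝ, t ^ 3 + p * t - v = ∏ k, (t - g k) := by
  -- As `δ²` is a nonpositive real number, `δ` is purely imaginary.
  have hδc : (starRingEnd ℂ) δ = -δ := by
    have hre := congrArg Complex.re hδ
    have him := congrArg Complex.im hδ
    simp only [pow_two, Complex.mul_re, Complex.mul_im, Complex.ofReal_re, Complex.ofReal_im]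
      at hre him
    have h0 : δ.re = 0 := by
      have : δ.re * δ.im = 0 := by linarith
      rcases mul_eq_zero.1 this with h | h
      · exact h
      · rw [h] at hre; nlinarith [sq_nonneg δ.re]
    apply Complex.ext <;> simp [h0]
  set η := (starRingEnd ℂ) ω with hη
  have hη3 : η ^ 3 = (-(v : ℂ) - δ) / 2 := by
    rw [hη, ← map_pow, hω]; simp [hδc, sub_eq_add_neg, map_ofNat]
  -- The two Cardano radicals `-ω` and `p/(3ω)` are conjugate: `|ω|² = -p/3` follows from its cube,
  -- which also covers `ω = 0`.
  have hprod : ω * η = -(p : ℂ) / 3 := by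
    rw [hη, Complex.mul_conj]
    have h3 : (Complex.normSq ω) ^ 3 = (-p / 3) ^ 3 := by
      apply Complex.ofReal_injective
      push_cast
      rw [← Complex.mul_conj, ← hη, mul_pow, hω, hη3]
      push_cast at hδ
      linear_combination -hδ / 4
    rw [(Odd.strictMono_pow (by decide : Odd 3)).injective h3]
    push_cast; ring
  have hζ3 : ζ ^ 3 = 1 := hζ.pow_eq_one
  have hζ0 : ζ ≠ 0 := hζ.ne_zero (by norm_num)
  have hζ2 : ζ ^ 2 + ζ + 1 = 0 := by
    have h1 : ζ - 1 ≠ 0 := sub_ne_zero.2 (hζ.ne_one (by norm_num))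
    apply mul_left_cancel₀ h1
    linear_combination hζ3
  have hζc : (starRingEnd ℂ) ζ = ζ⁻¹ :=
    (Complex.inv_eq_conj (hζ.norm'_eq_one (by norm_num))).symm
  have hζi : ζ⁻¹ = ζ ^ 2 := by
    rw [inv_eq_of_mul_eq_one_right]; linear_combination hζ3
  have hconj : ∀ k : Fin 3, (starRingEnd ℂ) (ζ ^ (k : ℕ) * ω) = (ζ ^ (k : ℕ))⁻¹ * η := fun k => by
    rw [map_mul, map_pow, hζc, inv_pow]
  have hg : ∀ k : Fin 3, ((-2 * (ζ ^ (k : ℕ) * ω).re : ℝ) : ℂ) =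
      -(ζ ^ (k : ℕ) * ω + (ζ ^ (k : ℕ))⁻¹ * η) := fun k => by
    rw [← hconj, Complex.add_conj]; push_cast; ring
  refine ⟨fun k => -2 * (ζ ^ (k : ℕ) * ω).re, fun k => ?_, fun t => ?_⟩
  · simp only [Complex.ofReal_neg, Complex.ofReal_sub, Complex.ofReal_mul (p : ℝ),
      Complex.ofReal_mul (3 * v), Complex.ofReal_pow, hg]
    have hA : (ζ ^ (k : ℕ) * ω) ^ 3 = (-(v : ℂ) + δ) / 2 := by
      rw [mul_pow, ← pow_mul, mul_comm (k : ℕ), pow_mul, hζ3, one_pow, one_mul, hω]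
    have hB : ((ζ ^ (k : ℕ))⁻¹ * η) ^ 3 = (-(v : ℂ) - δ) / 2 := by
      rw [mul_pow, inv_pow, ← pow_mul, mul_comm (k : ℕ), pow_mul, hζ3, one_pow, inv_one, one_mul,
        hη3]
    have hAB : (ζ ^ (k : ℕ) * ω) * ((ζ ^ (k : ℕ))⁻¹ * η) = -(p : ℂ) / 3 := by
      rw [← hprod]; field_simp
    unfold cardano
    rw [← hη]
    generalize ζ ^ (k : ℕ) * ω = A at *
    generalize (ζ ^ (k : ℕ))⁻¹ * η = B at *
    have hp : (p : ℂ) = -3 * (A * B) := by rw [hAB]; ring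
    have hv : (v : ℂ) = -(A ^ 3 + B ^ 3) := by rw [hA, hB]; ring
    have hd : δ = A ^ 3 - B ^ 3 := by rw [hA, hB]; ring
    push_cast
    rw [hp, hv, hd]; ring
  · apply Complex.ofReal_injective
    have hp : (p : ℂ) = -3 * (ω * η) := by rw [hprod]; ring
    have hv : (v : ℂ) = -(ω ^ 3 + η ^ 3) := by rw [hω, hη3]; ring
    have hi2 : (ζ ^ 2)⁻¹ = ζ := by rw [← hζi, inv_inv]
    rw [Complex.ofReal_prod]
    simp only [Complex.ofReal_sub, Complex.ofReal_add, Complex.ofReal_mul p, Complex.ofReal_pow,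
      hg, Fin.prod_univ_three, Fin.val_zero, Fin.val_one, Fin.val_two, pow_zero, pow_one,
      inv_one, one_mul]
    rw [hi2, hζi, hp, hv]
    linear_combination (-(t * ω * η * (ζ ^ 2 - ζ + 3)) - t * (ω ^ 2 + η ^ 2) * ζ - t ^ 2 * (ω + η)
      - (ω * η ^ 2 + ω ^ 2 * η) * ζ ^ 2 + (ω ^ 3 + η ^ 3) * (1 - ζ)) * hζ2

/-- If `v 1` is the smallest of three numbers, then `c` lies between the two smallest of them if and
only if `v 1 ≤ c` and `c` is at most the two others. -/
theorem two_smallest_iff {v θ : Fin 3 → ℝ} {ρ : Equiv.Perm (Fin 3)} (hθ : ∀ k, θ k = v (ρ k))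
    (hm : Monotone θ) (h₁₀ : v 1 ≤ v 0) (h₁₂ : v 1 ≤ v 2) (c : ℝ) :
    θ 0 ≤ c ∧ c ≤ θ 1 ↔ c ≤ v 0 ∧ v 1 ≤ c ∧ c ≤ v 2 := by
  have hm01 : θ 0 ≤ θ 1 := hm (by decide)
  have hm12 : θ 1 ≤ θ 2 := hm (by decide)
  have n01 : ρ 0 ≠ ρ 1 := ρ.injective.ne (by decide)
  have n02 : ρ 0 ≠ ρ 2 := ρ.injective.ne (by decide)
  have n12 : ρ 1 ≠ ρ 2 := ρ.injective.ne (by decide)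
  rw [hθ, hθ] at hm01 hm12
  rw [hθ, hθ]
  generalize ρ 0 = i at *
  generalize ρ 1 = j at *
  generalize ρ 2 = k at *
  clear hθ hm
  fin_cases i <;> fin_cases j <;> first | exact absurd rfl n01 | skip
  all_goals fin_cases k <;> first | exact absurd rfl n02 | exact absurd rfl n12 | skip
  all_goals
    simp only [Fin.zero_eta, Fin.mk_one, Fin.reduceFinMk, Fin.isValue] at *
    constructor
    · rintro ⟨_, _⟩
      refine ⟨?_, ?_, ?_⟩ <;> linarith
    · rintro ⟨_, _, _⟩
      constructor <;> linarith

theorem IsSortedCritical.depressed_eq {p r c g₁ g₂ g₃ : ℝ} (h : IsSortedCritical p r g₁ g₂ g₃) :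
    depressed p r c g₁ = c + (p * g₁ ^ 2 + 3 * r * g₁) ∧
    depressed p r c g₂ = c + (p * g₂ ^ 2 + 3 * r * g₂) ∧
    depressed p r c g₃ = c + (p * g₃ ^ 2 + 3 * r * g₃) := by
  obtain ⟨-, -, hs, he, hp⟩ := h
  unfold depressed
  refine ⟨?_, ?_, ?_⟩
  · linear_combination g₁ * (g₁ ^ 2 * hs - g₁ * he + hp)
  · linear_combination g₂ * (g₂ ^ 2 * hs - g₂ * he + hp)
  · linear_combination g₃ * (g₃ ^ 2 * hs - g₃ * he + hp)

/-- The value of the depressed quartic at the middle critical point is the largest of the three: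
the differences are `(g₂ - g₁)³ g₃` and `(g₂ - g₃)³ g₁`. -/
theorem IsSortedCritical.middle_max {p r g₁ g₂ g₃ : ℝ} (h : IsSortedCritical p r g₁ g₂ g₃) :
    p * g₁ ^ 2 + 3 * r * g₁ ≤ p * g₂ ^ 2 + 3 * r * g₂ ∧
    p * g₃ ^ 2 + 3 * r * g₃ ≤ p * g₂ ^ 2 + 3 * r * g₂ := by
  obtain ⟨h12, h23, hs, he, hp⟩ := h
  obtain rfl : r = -(g₁ * g₂ * g₃) := by linarith
  subst he
  have h3 : 0 ≤ g₃ := by linarith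
  have h1 : 0 ≤ -g₁ := by linarith
  obtain rfl : g₂ = -g₁ - g₃ := by linarith
  constructor
  · have := mul_nonneg (pow_nonneg (sub_nonneg.2 h12) 3) h3
    nlinarith
  · have := mul_nonneg (pow_nonneg (sub_nonneg.2 h23) 3) h1
    nlinarith

theorem exists_isSorting {s : Fin 3 → ℂ} {t : Fin 3 → ℝ} (h : ∀ k, s k = t k) :
    ∃ θ, IsSorting s θ :=
  ⟨t ∘ Tuple.sort t, Tuple.monotone_sort t, Tuple.sort t, fun k => by rw [h]; rfl⟩

/-- Real-rootedness of the depressed quartic `z⁴ + 2pz² - 4vz + c` in terms of the sorted set `S`,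
once the derivative is known to be real-rooted. -/
theorem depressed_real_rooted_iff {p v c : ℝ} {δ ζ ω : ℂ}
    (hδ : δ ^ 2 = ((v ^ 2 + 4 * p ^ 3 / 27 : ℝ) : ℂ))
    (hneg : v ^ 2 + 4 * p ^ 3 / 27 ≤ 0) (hζ : IsPrimitiveRoot ζ 3)
    (hω : ω ^ 3 = (-(v : ℂ) + δ) / 2) {θ : Fin 3 → ℝ} (hθ : IsSorting (cardano p v δ ζ ω) θ) :
    (∃ z : Fin 4 → ℝ, ∀ t, depressed p (-v) c t = ∏ i, (t - z i)) ↔ θ 0 ≤ c ∧ c ≤ θ 1 := by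
  obtain ⟨g, hgS, hg⟩ := exists_roots_of_cardano hδ hneg hζ hω
  obtain ⟨hmono, σ, hσ⟩ := hθ
  set τ := Tuple.sort g with hτ
  have hm : Monotone (g ∘ τ) := Tuple.monotone_sort g
  have hg' : ∀ t : ℝ, t ^ 3 + p * t - v = (t - g (τ 0)) * (t - g (τ 1)) * (t - g (τ 2)) :=
    fun t => by rw [hg, ← Equiv.prod_comp τ, Fin.prod_univ_three]
  have hcrit : IsSortedCritical p (-v) (g (τ 0)) (g (τ 1)) (g (τ 2)) := by
    have h0 := hg' 0
    have h1 := hg' 1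
    have h2 := hg' (-1)
    have h3 := hg' 2
    exact ⟨hm (show (0 : Fin 3) ≤ 1 by decide), hm (show (1 : Fin 3) ≤ 2 by decide),
      by linarith, by linarith, by linarith⟩
  obtain ⟨d1, d2, d3⟩ := hcrit.depressed_eq (c := c)
  obtain ⟨m1, m2⟩ := hcrit.middle_max
  set V : Fin 3 → ℝ := fun i => -(p * g (τ i) ^ 2 - 3 * v * g (τ i)) with hV
  have hθV : ∀ k, θ k = V ((σ.trans τ.symm) k) := fun k => by
    apply Complex.ofReal_injective
    rw [hσ, hgS]; simp [hV]
  rw [two_smallest_iff hθV hmono (by simp only [hV]; linarith) (by simp only [hV]; linarith)]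
  constructor
  · rintro ⟨z, hz⟩
    obtain ⟨s1, s2, s3⟩ := signs_of_real_rooted hcrit hz
    simp only [hV]
    refine ⟨?_, ?_, ?_⟩ <;> linarith
  · simp only [hV]
    rintro ⟨s1, s2, s3⟩
    exact exists_roots_of_signs hcrit (by linarith) (by linarith) (by linarith)

/-! ### Conditions (b), (d), (g): real-rootedness -/

theorem radicandD_eq (q a₁ a₂ : ℝ) : radicandD q a₁ a₂ = -48 * u₂ q a₁ a₂ := by
  unfold radicandD u₂; ring

theorem condB_iff {q a₁ a₂ : ℝ} : CondB q a₁ a₂ ↔ u₂ q a₁ a₂ ≤ 0 := by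
  unfold CondB u₂; constructor <;> intro h <;> linarith

/-- Condition (d) reads `|4u₃| ≤ (-48u₂)^(3/2) / 216`; squaring gives `Δ ≤ 0`. -/
theorem condD_iff {q a₁ a₂ a₃ : ℝ} (hB : CondB q a₁ a₂) : CondD q a₁ a₂ a₃ ↔ Δ q a₁ a₂ a₃ ≤ 0 := by
  have hD : 0 ≤ radicandD q a₁ a₂ := by
    rw [radicandD_eq]; linarith [condB_iff.1 hB]
  set R := radicandD q a₁ a₂ ^ (3 / 2 : ℝ) with hR
  have hR0 : 0 ≤ R := Real.rpow_nonneg hD _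
  have hR2 : R ^ 2 = (-48 * u₂ q a₁ a₂) ^ 3 := by
    rw [hR, ← Real.rpow_natCast, ← Real.rpow_mul hD, ← radicandD_eq, ← Real.rpow_natCast]
    norm_num
  have h1 : CondD q a₁ a₂ a₃ ↔ |4 * u₃ q a₁ a₂ a₃| ≤ R / 216 := by
    rw [CondD, abs_le, ← hR]
    unfold u₃
    constructor <;> rintro ⟨_, _⟩ <;> constructor <;> linarith
  rw [h1, ← abs_of_nonneg (show 0 ≤ R / 216 by positivity), ← sq_le_sq, div_pow, hR2, Δ]
  constructor <;> intro h <;> linarith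

theorem real_rooted_iff_depressed {q a₁ a₂ a₃ a₄ : ℝ} :
    (∃ x, IsQuarticRoots a₁ (a₂ - 4 * q) (a₃ - 3 * q * a₁) (a₄ - 2 * q * a₂ + 2 * q ^ 2) x) ↔
      ∃ z : Fin 4 → ℝ, ∀ t, depressed (u₂ q a₁ a₂) (-u₃ q a₁ a₂ a₃) (a₄ - baseG q a₁ a₂ a₃) t =
        ∏ i, (t - z i) := by
  have key : ∀ t, depressed (u₂ q a₁ a₂) (-u₃ q a₁ a₂ a₃) (a₄ - baseG q a₁ a₂ a₃) (t + a₁ / 4) =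
      t ^ 4 + a₁ * t ^ 3 + (a₂ - 4 * q) * t ^ 2 + (a₃ - 3 * q * a₁) * t
        + (a₄ - 2 * q * a₂ + 2 * q ^ 2) := fun t => by
    unfold depressed u₂ u₃ baseG; ring
  constructor
  · rintro ⟨x, hx⟩
    refine ⟨fun i => x i + a₁ / 4, fun t => ?_⟩
    have := key (t - a₁ / 4)
    rw [sub_add_cancel, hx] at this
    rw [this]
    exact Finset.prod_congr rfl fun i _ => by ring
  · rintro ⟨z, hz⟩
    refine ⟨fun i => z i - a₁ / 4, fun t => ?_⟩
    rw [← key, hz]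
    exact Finset.prod_congr rfl fun i _ => by ring

theorem real_rooted_iff {q a₁ a₂ a₃ a₄ : ℝ} {δ ζ ω : ℂ}
    (hδ : δ ^ 2 = (Δ q a₁ a₂ a₃ : ℂ)) (hζ : IsPrimitiveRoot ζ 3)
    (hω : ω ^ 3 = (-(u₃ q a₁ a₂ a₃ : ℂ) + δ) / 2) :
    (∃ x, IsQuarticRoots a₁ (a₂ - 4 * q) (a₃ - 3 * q * a₁) (a₄ - 2 * q * a₂ + 2 * q ^ 2) x) ↔
      CondB q a₁ a₂ ∧ CondD q a₁ a₂ a₃ ∧ ∃ θ : Fin 3 → ℝ,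
        IsSorting (cardano (u₂ q a₁ a₂) (u₃ q a₁ a₂ a₃) δ ζ ω) θ ∧
        CondG q a₁ a₂ a₃ a₄ (θ 0) (θ 1) := by
  have hG : ∀ θ₁ θ₂, CondG q a₁ a₂ a₃ a₄ θ₁ θ₂ ↔
      θ₁ ≤ a₄ - baseG q a₁ a₂ a₃ ∧ a₄ - baseG q a₁ a₂ a₃ ≤ θ₂ := fun θ₁ θ₂ => by
    unfold CondG; constructor <;> rintro ⟨_, _⟩ <;> constructor <;> linarith
  rw [real_rooted_iff_depressed]
  constructor
  · intro hz
    obtain ⟨z, hz'⟩ := hz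
    obtain ⟨hp, hneg⟩ := disc_of_real_rooted hz'
    rw [neg_sq] at hneg
    have hB : CondB q a₁ a₂ := condB_iff.2 hp
    obtain ⟨g, hg, -⟩ := exists_roots_of_cardano hδ hneg hζ hω
    obtain ⟨θ, hθ⟩ := exists_isSorting hg
    exact ⟨hB, (condD_iff hB).2 hneg, θ, hθ,
      (hG _ _).2 ((depressed_real_rooted_iff hδ hneg hζ hω hθ).1 ⟨z, hz'⟩)⟩
  · rintro ⟨hB, hD, θ, hθ, h⟩
    exact (depressed_real_rooted_iff hδ ((condD_iff hB).1 hD) hζ hω hθ).2 ((hG _ _).1 h)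

/-! ### Conditions (a), (b*), (c), (e): location of the roots -/

/-- The Taylor coefficients at `2s` of the monic quartic with roots `xᵢ` are the elementary
symmetric functions of the `2s - xᵢ`. -/
theorem taylor_at_endpoint {s a₁ a₂ a₃ a₄ : ℝ} {x : Fin 4 → ℝ}
    (hx : IsQuarticRoots a₁ (a₂ - 4 * s ^ 2) (a₃ - 3 * s ^ 2 * a₁)
      (a₄ - 2 * s ^ 2 * a₂ + 2 * (s ^ 2) ^ 2) x) {y : Fin 4 → ℝ} (hy : ∀ i, y i = 2 * s - x i) :
    8 * s + a₁ = y 0 + y 1 + y 2 + y 3 ∧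
    20 * s ^ 2 + 6 * s * a₁ + a₂ =
      y 0 * y 1 + y 0 * y 2 + y 0 * y 3 + y 1 * y 2 + y 1 * y 3 + y 2 * y 3 ∧
    16 * s ^ 3 + 9 * s ^ 2 * a₁ + 4 * s * a₂ + a₃ =
      y 0 * y 1 * y 2 + y 0 * y 1 * y 3 + y 0 * y 2 * y 3 + y 1 * y 2 * y 3 ∧
    2 * s ^ 4 + 2 * s ^ 2 * a₂ + a₄ + 2 * s * (s ^ 2 * a₁ + a₃) = y 0 * y 1 * y 2 * y 3 := by
  obtain ⟨h1, h2, h3, h4⟩ := isQuarticRoots_iff.1 hx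
  simp only [hy]
  refine ⟨?_, ?_, ?_, ?_⟩
  · linear_combination h1
  · linear_combination h2 + 6 * s * h1
  · linear_combination h3 + 4 * s * h2 + 12 * s ^ 2 * h1
  · linear_combination h4 + 2 * s * h3 + 4 * s ^ 2 * h2 + 8 * s ^ 3 * h1

/-- The analogue of `taylor_at_endpoint` at `-2s`, with alternating signs. -/
theorem taylor_at_neg_endpoint {s a₁ a₂ a₃ a₄ : ℝ} {x : Fin 4 → ℝ}
    (hx : IsQuarticRoots a₁ (a₂ - 4 * s ^ 2) (a₃ - 3 * s ^ 2 * a₁)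
      (a₄ - 2 * s ^ 2 * a₂ + 2 * (s ^ 2) ^ 2) x) {y : Fin 4 → ℝ} (hy : ∀ i, y i = 2 * s + x i) :
    8 * s - a₁ = y 0 + y 1 + y 2 + y 3 ∧
    20 * s ^ 2 - 6 * s * a₁ + a₂ =
      y 0 * y 1 + y 0 * y 2 + y 0 * y 3 + y 1 * y 2 + y 1 * y 3 + y 2 * y 3 ∧
    16 * s ^ 3 - 9 * s ^ 2 * a₁ + 4 * s * a₂ - a₃ =
      y 0 * y 1 * y 2 + y 0 * y 1 * y 3 + y 0 * y 2 * y 3 + y 1 * y 2 * y 3 ∧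
    2 * s ^ 4 + 2 * s ^ 2 * a₂ + a₄ - 2 * s * (s ^ 2 * a₁ + a₃) = y 0 * y 1 * y 2 * y 3 := by
  obtain ⟨h1, h2, h3, h4⟩ := isQuarticRoots_iff.1 hx
  simp only [hy]
  refine ⟨?_, ?_, ?_, ?_⟩
  · linear_combination -h1
  · linear_combination h2 - 6 * s * h1
  · linear_combination -h3 + 4 * s * h2 - 12 * s ^ 2 * h1
  · linear_combination h4 - 2 * s * h3 + 4 * s ^ 2 * h2 - 8 * s ^ 3 * h1

section
variable {s a₁ a₂ a₃ a₄ : ℝ}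

theorem condA_sq_iff (hs : 0 ≤ s) : CondA (s ^ 2) a₁ ↔ 0 ≤ 8 * s + a₁ ∧ 0 ≤ 8 * s - a₁ := by
  rw [CondA, Real.sqrt_sq hs, abs_le]
  constructor <;> rintro ⟨_, _⟩ <;> constructor <;> linarith

theorem condBStar_sq_iff (hs : 0 ≤ s) : CondBStar (s ^ 2) a₁ a₂ ↔
    0 ≤ 20 * s ^ 2 + 6 * s * a₁ + a₂ ∧ 0 ≤ 20 * s ^ 2 - 6 * s * a₁ + a₂ := by
  have h : 6 * s * |a₁| = |6 * s * a₁| := by rw [abs_mul, abs_of_nonneg (by positivity : 0 ≤ 6 * s)]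
  rw [CondBStar, Real.sqrt_sq hs, h, sub_le_iff_le_add, abs_le]
  constructor <;> rintro ⟨_, _⟩ <;> constructor <;> linarith

theorem condC_sq_iff (hs : 0 ≤ s) : CondC (s ^ 2) a₁ a₂ a₃ ↔
    0 ≤ 16 * s ^ 3 + 9 * s ^ 2 * a₁ + 4 * s * a₂ + a₃ ∧
    0 ≤ 16 * s ^ 3 - 9 * s ^ 2 * a₁ + 4 * s * a₂ - a₃ := by
  rw [CondC, lowerC, upperC, Real.sqrt_sq hs]
  constructor <;> rintro ⟨_, _⟩ <;> constructor <;> linarith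

theorem condE_sq_iff (hs : 0 ≤ s) : CondE (s ^ 2) a₁ a₂ a₃ a₄ ↔
    0 ≤ 2 * s ^ 4 + 2 * s ^ 2 * a₂ + a₄ + 2 * s * (s ^ 2 * a₁ + a₃) ∧
    0 ≤ 2 * s ^ 4 + 2 * s ^ 2 * a₂ + a₄ - 2 * s * (s ^ 2 * a₁ + a₃) := by
  have h : 2 * s * |s ^ 2 * a₁ + a₃| = |2 * s * (s ^ 2 * a₁ + a₃)| := by
    rw [abs_mul, abs_of_nonneg (by positivity : 0 ≤ 2 * s)]
  rw [CondE, lowerE, Real.sqrt_sq hs, h, sub_sub, sub_le_iff_le_add, abs_le]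
  constructor <;> rintro ⟨_, _⟩ <;> constructor <;> linarith

theorem someEquality_sq_iff (hs : 0 ≤ s) (hA : CondA (s ^ 2) a₁) (hB : CondBStar (s ^ 2) a₁ a₂)
    (hE : CondE (s ^ 2) a₁ a₂ a₃ a₄) : SomeEquality (s ^ 2) a₁ a₂ a₃ a₄ ↔
    (8 * s + a₁ = 0 ∨ 8 * s - a₁ = 0) ∨
    (20 * s ^ 2 + 6 * s * a₁ + a₂ = 0 ∨ 20 * s ^ 2 - 6 * s * a₁ + a₂ = 0) ∨
    (16 * s ^ 3 + 9 * s ^ 2 * a₁ + 4 * s * a₂ + a₃ = 0 ∨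
      16 * s ^ 3 - 9 * s ^ 2 * a₁ + 4 * s * a₂ - a₃ = 0) ∨
    (2 * s ^ 4 + 2 * s ^ 2 * a₂ + a₄ + 2 * s * (s ^ 2 * a₁ + a₃) = 0 ∨
      2 * s ^ 4 + 2 * s ^ 2 * a₂ + a₄ - 2 * s * (s ^ 2 * a₁ + a₃) = 0) := by
  -- For `m ≥ |t|`, the equality `|t| = m` means that `m + t` or `m - t` vanishes.
  have habs : ∀ {t m : ℝ}, 0 ≤ m + t → 0 ≤ m - t → (|t| = m ↔ m + t = 0 ∨ m - t = 0) := by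
    intro t m h1 h2
    rw [abs_eq (by linarith)]
    constructor <;> rintro (h | h)
    exacts [Or.inr (by linarith), Or.inl (by linarith), Or.inr (by linarith), Or.inl (by linarith)]
  rw [condA_sq_iff hs] at hA
  rw [condBStar_sq_iff hs] at hB
  rw [condE_sq_iff hs] at hE
  unfold SomeEquality lowerC upperC lowerE
  rw [Real.sqrt_sq hs]
  refine or_congr (habs hA.1 hA.2) (or_congr ?_ (or_congr (or_congr ?_ ?_) ?_))
  · have h : 6 * s * |a₁| = |6 * s * a₁| := by
      rw [abs_mul, abs_of_nonneg (by positivity : 0 ≤ 6 * s)]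
    rw [h, sub_eq_iff_eq_add, habs (by linarith) (by linarith)]
    refine or_congr ?_ ?_ <;> constructor <;> intro h <;> linarith
  · constructor <;> intro h <;> linarith
  · constructor <;> intro h <;> linarith
  · have h : 2 * s * |s ^ 2 * a₁ + a₃| = |2 * s * (s ^ 2 * a₁ + a₃)| := by
      rw [abs_mul, abs_of_nonneg (by positivity : 0 ≤ 2 * s)]
    rw [h, sub_sub, sub_eq_iff_eq_add, habs (by linarith) (by linarith)]
    refine or_congr ?_ ?_ <;> constructor <;> intro h <;> linarith

theorem roots_bounded_iff {x : Fin 4 → ℝ}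
    (hx : IsQuarticRoots a₁ (a₂ - 4 * s ^ 2) (a₃ - 3 * s ^ 2 * a₁)
      (a₄ - 2 * s ^ 2 * a₂ + 2 * (s ^ 2) ^ 2) x)
    (hs : 0 ≤ s) :
    (∀ i, |x i| ≤ 2 * s) ↔ CondA (s ^ 2) a₁ ∧
    CondBStar (s ^ 2) a₁ a₂ ∧ CondC (s ^ 2) a₁ a₂ a₃ ∧ CondE (s ^ 2) a₁ a₂ a₃ a₄ := by
  obtain ⟨p1, p2, p3, p4⟩ := taylor_at_endpoint hx (y := fun i => 2 * s - x i) fun _ => rfl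
  obtain ⟨m1, m2, m3, m4⟩ := taylor_at_neg_endpoint hx (y := fun i => 2 * s + x i) fun _ => rfl
  rw [condA_sq_iff hs, condBStar_sq_iff hs, condC_sq_iff hs, condE_sq_iff hs,
    p1, p2, p3, p4, m1, m2, m3, m4]
  constructor
  · intro h
    obtain ⟨n1, n2, n3, n4⟩ := esymm_nonneg (x := fun i => 2 * s - x i)
      fun i => by linarith [(abs_le.1 (h i)).2]
    obtain ⟨k1, k2, k3, k4⟩ := esymm_nonneg (x := fun i => 2 * s + x i)
      fun i => by linarith [(abs_le.1 (h i)).1]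
    exact ⟨⟨n1, k1⟩, ⟨n2, k2⟩, ⟨n3, k3⟩, n4, k4⟩
  · rintro ⟨⟨n1, k1⟩, ⟨n2, k2⟩, ⟨n3, k3⟩, n4, k4⟩ i
    have hn := nonneg_of_esymm_nonneg (x := fun i => 2 * s - x i) n1 n2 n3 n4 i
    have hk := nonneg_of_esymm_nonneg (x := fun i => 2 * s + x i) k1 k2 k3 k4 i
    exact abs_le.2 ⟨by linarith, by linarith⟩

theorem exists_root_at_endpoint_iff {x : Fin 4 → ℝ}
    (hx : IsQuarticRoots a₁ (a₂ - 4 * s ^ 2) (a₃ - 3 * s ^ 2 * a₁)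
      (a₄ - 2 * s ^ 2 * a₂ + 2 * (s ^ 2) ^ 2) x)
    (hs : 0 ≤ s) (hb : ∀ i, |x i| ≤ 2 * s) :
    (∃ i, |x i| = 2 * s) ↔ SomeEquality (s ^ 2) a₁ a₂ a₃ a₄ := by
  obtain ⟨hA, hB, -, hE⟩ := (roots_bounded_iff hx hs).1 hb
  obtain ⟨p1, p2, p3, p4⟩ := taylor_at_endpoint hx (y := fun i => 2 * s - x i) fun _ => rfl
  obtain ⟨m1, m2, m3, m4⟩ := taylor_at_neg_endpoint hx (y := fun i => 2 * s + x i) fun _ => rfl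
  rw [someEquality_sq_iff hs hA hB hE, p1, p2, p3, p4, m1, m2, m3, m4]
  constructor
  · rintro ⟨i, hi⟩
    refine Or.inr (Or.inr (Or.inr ?_))
    rcases (abs_eq (by positivity)).1 hi with h | h
    · left
      have := Finset.prod_eq_zero (f := fun j => 2 * s - x j) (Finset.mem_univ i) (by linarith)
      rwa [Fin.prod_univ_four] at this
    · right
      have := Finset.prod_eq_zero (f := fun j => 2 * s + x j) (Finset.mem_univ i) (by linarith)
      rwa [Fin.prod_univ_four] at this
  · intro h
    by_contra! hne
    have hlt : ∀ i, |x i| < 2 * s := fun i => lt_of_le_of_ne (hb i) (hne i)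
    obtain ⟨n1, n2, n3, n4⟩ := esymm_pos (x := fun i => 2 * s - x i)
      fun i => by linarith [(abs_lt.1 (hlt i)).2]
    obtain ⟨k1, k2, k3, k4⟩ := esymm_pos (x := fun i => 2 * s + x i)
      fun i => by linarith [(abs_lt.1 (hlt i)).1]
    rcases h with (h | h) | (h | h) | (h | h) | (h | h)
    exacts [n1.ne' h, k1.ne' h, n2.ne' h, k2.ne' h, n3.ne' h, k3.ne' h, n4.ne' h, k4.ne' h]

end

/-! ### Weil polynomials with a real root -/

theorem aroots_X_sub_C_sq (r : ℤ) : ((X - C r) ^ 2 : ℤ[X]).aroots ℂ = {(r : ℂ), (r : ℂ)} := by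
  rw [aroots_pow, aroots_X_sub_C, two_nsmul]; rfl

theorem aroots_X_sq_sub_C_sq (q : ℕ) : ((X ^ 2 - C (q : ℤ)) ^ 2 : ℤ[X]).aroots ℂ =
    {((√q : ℝ) : ℂ), -((√q : ℝ) : ℂ), ((√q : ℝ) : ℂ), -((√q : ℝ) : ℂ)} := by
  have hq : ((√q : ℝ) : ℂ) ^ 2 = q := by
    rw [← Complex.ofReal_pow, Real.sq_sqrt (Nat.cast_nonneg q)]; simp
  have h : (X ^ 2 - C (q : ℤ) : ℤ[X]).map (algebraMap ℤ ℂ) =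
      (({((√q : ℝ) : ℂ), -((√q : ℝ) : ℂ)} : Multiset ℂ).map fun z => X - C z).prod := by
    simp only [Polynomial.map_sub, Polynomial.map_pow, map_X, map_C, Multiset.insert_eq_cons,
      Multiset.map_cons, Multiset.map_singleton, Multiset.prod_cons, Multiset.prod_singleton]
    rw [show algebraMap ℤ ℂ q = ((√q : ℝ) : ℂ) ^ 2 by rw [hq]; simp, C_pow, C_neg]
    ring
  rw [aroots_pow, aroots_def, h, roots_multiset_prod_X_sub_C, two_nsmul]; rfl

theorem norm_eq_of_sq_eq {q r : ℕ} (hr : r ^ 2 = q) {ε : ℤ} (hε : ε = r ∨ ε = -r) :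
    ‖(ε : ℂ)‖ = √q := by
  rw [← hr, Nat.cast_pow, Real.sqrt_sq (Nat.cast_nonneg r)]
  rcases hε with rfl | rfl <;> simp

theorem mem_of_sq_factor {q r g : ℕ} (hr : r ^ 2 = q) {ε : ℤ} (hε : ε = r ∨ ε = -r) {h₀ : ℤ[X]}
    (h : h₀ ∈ weilPolys q g) : (X - C ε) ^ 2 * h₀ ∈ weilPolys q (1 + g) := by
  refine mul_mem_weilPolys h ((monic_X_sub_C ε).pow 2) (M := {(ε : ℂ)}) (by simp) ?_ ?_
  · simpa using norm_eq_of_sq_eq hr hε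
  · rw [aroots_X_sub_C_sq]; simp

theorem mem_of_quartic_factor {q g : ℕ} {h₀ : ℤ[X]} (h : h₀ ∈ weilPolys q g) :
    (X ^ 2 - C (q : ℤ)) ^ 2 * h₀ ∈ weilPolys q (2 + g) := by
  refine mul_mem_weilPolys h ((monic_X_pow_sub_C _ two_ne_zero).pow 2)
    (M := {((√q : ℝ) : ℂ), -((√q : ℝ) : ℂ)}) (by simp) ?_ ?_
  · simp [abs_of_nonneg]
  · rw [aroots_X_sq_sub_C_sq]
    simpa using Multiset.cons_swap _ _ _

/-- A real root of a Weil polynomial is one of the chosen representatives of the conjugate pairs. -/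
theorem mem_of_real_root {h : ℤ[X]} (hm : h.Monic) {M : Multiset ℂ}
    (hr : h.aroots ℂ = M + M.map (starRingEnd ℂ)) {y : ℝ} (hy : aeval y h = 0) : (y : ℂ) ∈ M := by
  have : (y : ℂ) ∈ h.aroots ℂ := by
    rw [mem_aroots]
    refine ⟨hm.ne_zero, ?_⟩
    have := aeval_algebraMap_apply ℂ y h
    rw [hy, map_zero] at this
    exact this
  rw [hr, Multiset.mem_add, Multiset.mem_map] at this
  rcases this with h | ⟨w, hw, hwy⟩
  · exact h
  · have := congrArg (starRingEnd ℂ) hwy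
    rw [Complex.conj_conj, Complex.conj_ofReal] at this
    rwa [← this]

theorem eq_or_eq_neg_sqrt {q : ℕ} {h : ℤ[X]} (hm : h.Monic) {M : Multiset ℂ}
    (hn : ∀ z ∈ M, ‖z‖ = √q) (hr : h.aroots ℂ = M + M.map (starRingEnd ℂ)) {y : ℝ}
    (hy : aeval y h = 0) : y = √q ∨ y = -√q := by
  have := hn _ (mem_of_real_root hm hr hy)
  rw [Complex.norm_real, Real.norm_eq_abs] at this
  exact (abs_eq (Real.sqrt_nonneg _)).1 this

theorem exists_sq_factor {q r g : ℕ} (hg : 0 < g) (hr : r ^ 2 = q) {h : ℤ[X]}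
    (hh : h ∈ weilPolys q (g + 1)) (hreal : HasRealRoot h) :
    ∃ ε : ℤ, (ε = r ∨ ε = -r) ∧ ∃ h₀ ∈ weilPolys q g, h = (X - C ε) ^ 2 * h₀ := by
  obtain ⟨-, hm, M, hM, hn, hroots⟩ := mem_weilPolys_iff.1 hh
  obtain ⟨y, hy⟩ := hreal
  have hsq : √(q : ℝ) = r := by rw [← hr, Nat.cast_pow, Real.sqrt_sq (Nat.cast_nonneg r)]
  obtain ⟨ε, hε, rfl⟩ : ∃ ε : ℤ, (ε = r ∨ ε = -r) ∧ y = ε := by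
    rcases eq_or_eq_neg_sqrt hm hn hroots hy with h | h
    · exact ⟨r, Or.inl rfl, by rw [h, hsq]; simp⟩
    · exact ⟨-r, Or.inr rfl, by rw [h, hsq]; simp⟩
  refine ⟨ε, hε, ?_⟩
  obtain ⟨N, rfl⟩ := Multiset.exists_cons_of_mem (mem_of_real_root hm hroots hy)
  refine exists_mul_of_aroots hg hm ((monic_X_sub_C ε).pow 2) (M := N) (by simpa using hM)
    (fun z hz => hn z (Multiset.mem_cons_of_mem hz)) ?_
  rw [hroots, aroots_X_sub_C_sq]
  simp only [Multiset.map_cons, map_intCast, Complex.ofReal_intCast]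
  simp only [Multiset.insert_eq_cons, ← Multiset.singleton_add]
  abel

/-- When `q` is not a square, `√q` is irrational, so that `√q` and `-√q` are roots of the same
integer polynomials. -/
theorem aeval_octic_neg {q : ℕ} (hq : ¬ IsSquare q) {a₁ a₂ a₃ a₄ : ℤ} {y : ℝ} (hy2 : y ^ 2 = q)
    (hy : aeval y (octic q a₁ a₂ a₃ a₄) = 0) : aeval (-y) (octic q a₁ a₂ a₃ a₄) = 0 := by
  have hq0 : (q : ℝ) ≠ 0 := by
    rintro h
    rw [Nat.cast_eq_zero] at h
    exact hq ⟨0, by simp [h]⟩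
  have hirr : Irrational y := by
    have hs := irrational_sqrt_natCast_iff.2 hq
    have hsq := hy2.trans (Real.sq_sqrt (Nat.cast_nonneg q)).symm
    rcases sq_eq_sq_iff_eq_or_eq_neg.1 hsq with h | h
    · rwa [h]
    · rw [h]; exact hs.neg
  set A : ℤ := 2 * q ^ 2 + 2 * a₂ * q + a₄ with hA
  set B : ℤ := 2 * (a₁ * q + a₃) with hB
  have key : ∀ t : ℝ, t ^ 2 = q → aeval t (octic q a₁ a₂ a₃ a₄) = q ^ 2 * (A + B * t) := by
    intro t ht
    simp only [octic, map_add, map_mul, map_pow, aeval_X, aeval_C, hA, hB]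
    rw [← ht]
    simp [← ht]
    ring
  -- The value at a square root `t` of `q` is `q²(A + Bt)`, so irrationality forces `A = B = 0`.
  rw [key y hy2] at hy
  have hAB : (A : ℝ) + B * y = 0 := (mul_eq_zero.1 hy).resolve_left (pow_ne_zero 2 hq0)
  have hB0 : B = 0 := by
    by_contra hne
    exact ((hirr.intCast_mul hne).intCast_add A).ne_zero hAB
  have hA0 : (A : ℝ) = 0 := by simpa [hB0] using hAB
  rw [key (-y) (by rw [neg_sq, hy2]), hA0, hB0]
  simp

theorem exists_quartic_factor {q : ℕ} (hq : ¬ IsSquare q) {a₁ a₂ a₃ a₄ : ℤ}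
    (hh : octic q a₁ a₂ a₃ a₄ ∈ weilPolys q 4) (hreal : HasRealRoot (octic q a₁ a₂ a₃ a₄)) :
    ∃ h₀ ∈ weilPolys q 2, octic q a₁ a₂ a₃ a₄ = (X ^ 2 - C (q : ℤ)) ^ 2 * h₀ := by
  obtain ⟨-, hm, M, hM, hn, hroots⟩ := mem_weilPolys_iff.1 hh
  obtain ⟨y, hy⟩ := hreal
  have hs2 : √(q : ℝ) ^ 2 = q := Real.sq_sqrt (Nat.cast_nonneg q)
  have hs0 : √(q : ℝ) ≠ 0 := (irrational_sqrt_natCast_iff.2 hq).ne_zero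
  have hboth : aeval (√(q : ℝ)) (octic q a₁ a₂ a₃ a₄) = 0 ∧
      aeval (-√(q : ℝ)) (octic q a₁ a₂ a₃ a₄) = 0 := by
    rcases eq_or_eq_neg_sqrt hm hn hroots hy with rfl | rfl
    · exact ⟨hy, aeval_octic_neg hq hs2 hy⟩
    · exact ⟨by simpa using aeval_octic_neg hq (by rw [neg_sq, hs2]) hy, hy⟩
  have m1 := mem_of_real_root hm hroots hboth.1
  have m2 := mem_of_real_root hm hroots hboth.2
  obtain ⟨N, rfl⟩ := Multiset.exists_cons_of_mem m1
  have m2' : ((-√(q : ℝ) : ℝ) : ℂ) ∈ N := by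
    refine (Multiset.mem_cons.1 m2).resolve_left fun h => hs0 ?_
    have := Complex.ofReal_injective h
    linarith
  obtain ⟨N, rfl⟩ := Multiset.exists_cons_of_mem m2'
  refine exists_mul_of_aroots two_pos hm ((monic_X_pow_sub_C _ two_ne_zero).pow 2) (M := N)
    (by simpa using hM)
    (fun z hz => hn z (Multiset.mem_cons_of_mem (Multiset.mem_cons_of_mem hz))) ?_
  rw [hroots, aroots_X_sq_sub_C_sq]
  simp only [Multiset.map_cons, Complex.conj_ofReal, Complex.ofReal_neg, map_neg]
  simp only [Multiset.insert_eq_cons, ← Multiset.singleton_add]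
  abel

theorem mem_and_hasRealRoot_iff {q : ℕ} {a₁ a₂ a₃ a₄ : ℤ} :
    octic q a₁ a₂ a₃ a₄ ∈ weilPolys q 4 ∧ HasRealRoot (octic q a₁ a₂ a₃ a₄) ↔
      CaseI q (octic q a₁ a₂ a₃ a₄) ∨ CaseII q (octic q a₁ a₂ a₃ a₄) := by
  have hX : ∀ r : ℤ, (X + C r : ℤ[X]) = X - C (-r) := fun r => by rw [C_neg, sub_neg_eq_add]
  constructor
  · rintro ⟨hh, hreal⟩
    by_cases hq : IsSquare q
    · obtain ⟨r, hr⟩ := hq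
      have hr : r ^ 2 = q := by rw [hr, sq]
      obtain ⟨ε, hε | hε, h₀, hh₀, heq⟩ := exists_sq_factor (by norm_num) hr hh hreal
      · exact Or.inl ⟨r, hr, h₀, hh₀, Or.inr (by rw [heq, hε])⟩
      · exact Or.inl ⟨r, hr, h₀, hh₀, Or.inl (by rw [heq, hε, hX])⟩
    · exact Or.inr ⟨hq, exists_quartic_factor hq hh hreal⟩
  · rintro (⟨r, hr, h₀, hh₀, heq⟩ | ⟨-, h₀, hh₀, heq⟩)
    · obtain ⟨ε, hε, heq⟩ : ∃ ε : ℤ, (ε = r ∨ ε = -r) ∧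
          octic q a₁ a₂ a₃ a₄ = (X - C ε) ^ 2 * h₀ := by
        rcases heq with h | h
        · exact ⟨-r, Or.inr rfl, by rw [h, hX]⟩
        · exact ⟨r, Or.inl rfl, h⟩
      rw [heq]
      exact ⟨mem_of_sq_factor hr hε hh₀, ε, by simp⟩
    · rw [heq]
      exact ⟨mem_of_quartic_factor hh₀, √q, by simp [Real.sq_sqrt]⟩

end QWeil

theorem theoremB (q : ℕ) (hq : IsPrimePow q) (a₁ a₂ a₃ a₄ : ℤ) (δ ζ ω : ℂ)
    (hδ : δ ^ 2 = (QWeil.Δ q a₁ a₂ a₃ : ℂ))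
    (hζ : IsPrimitiveRoot ζ 3)
    (hω : ω ^ 3 = (-(QWeil.u₃ q a₁ a₂ a₃ : ℂ) + δ) / 2) :
    -- the quantity between parentheses in (d) is non-negative by (b)
    (QWeil.CondB q a₁ a₂ → 0 ≤ QWeil.radicandD q a₁ a₂) ∧
    -- reality of the set S
    ((QWeil.octic q a₁ a₂ a₃ a₄ ∈ QWeil.weilPolys q 4 ∨
        (QWeil.CondA q a₁ ∧ QWeil.CondBStar q a₁ a₂ ∧ QWeil.CondB q a₁ a₂ ∧
          QWeil.CondC q a₁ a₂ a₃ ∧ QWeil.CondD q a₁ a₂ a₃)) →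
      ∀ k : Fin 3, ∃ t : ℝ,
        QWeil.cardano (QWeil.u₂ q a₁ a₂) (QWeil.u₃ q a₁ a₂ a₃) δ ζ ω k = (t : ℂ)) ∧
    -- membership in W_q(4)
    (QWeil.octic q a₁ a₂ a₃ a₄ ∈ QWeil.weilPolys q 4 ↔
      QWeil.CondA q a₁ ∧ QWeil.CondBStar q a₁ a₂ ∧ QWeil.CondB q a₁ a₂ ∧
        QWeil.CondC q a₁ a₂ a₃ ∧ QWeil.CondD q a₁ a₂ a₃ ∧ QWeil.CondE q a₁ a₂ a₃ a₄ ∧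
        ∃ θ : Fin 3 → ℝ,
          QWeil.IsSorting
            (QWeil.cardano (QWeil.u₂ q a₁ a₂) (QWeil.u₃ q a₁ a₂ a₃) δ ζ ω) θ ∧
          QWeil.CondG q a₁ a₂ a₃ a₄ (θ 0) (θ 1)) ∧
    -- real roots in terms of equalities
    (QWeil.octic q a₁ a₂ a₃ a₄ ∈ QWeil.weilPolys q 4 →
      (QWeil.HasRealRoot (QWeil.octic q a₁ a₂ a₃ a₄) ↔
        QWeil.SomeEquality q a₁ a₂ a₃ a₄)) ∧
    -- real roots explicitly
    (QWeil.octic q a₁ a₂ a₃ a₄ ∈ QWeil.weilPolys q 4 ∧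
        QWeil.HasRealRoot (QWeil.octic q a₁ a₂ a₃ a₄) ↔
      QWeil.CaseI q (QWeil.octic q a₁ a₂ a₃ a₄) ∨
        QWeil.CaseII q (QWeil.octic q a₁ a₂ a₃ a₄)) ∧
    ¬ (QWeil.CaseI q (QWeil.octic q a₁ a₂ a₃ a₄) ∧
        QWeil.CaseII q (QWeil.octic q a₁ a₂ a₃ a₄)) := by
  have hs : 0 ≤ √(q : ℝ) := Real.sqrt_nonneg _
  have hq2 : √(q : ℝ) ^ 2 = q := Real.sq_sqrt (Nat.cast_nonneg q)
  have hrr := QWeil.real_rooted_iff (a₄ := (a₄ : ℝ)) hδ hζ hω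
  have hbd : ∀ {x : Fin 4 → ℝ}, QWeil.IsQuarticRoots a₁ (a₂ - 4 * q) (a₃ - 3 * q * a₁)
      (a₄ - 2 * q * a₂ + 2 * q ^ 2) x → ((∀ i, |x i| ≤ 2 * √(q : ℝ)) ↔
        QWeil.CondA q a₁ ∧ QWeil.CondBStar q a₁ a₂ ∧ QWeil.CondC q a₁ a₂ a₃ ∧
          QWeil.CondE q a₁ a₂ a₃ a₄) :=
    fun {x} hx => by
      have := QWeil.roots_bounded_iff (by rwa [hq2]) hs (x := x) (a₁ := a₁) (a₂ := a₂) (a₃ := a₃)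
        (a₄ := a₄)
      rwa [hq2] at this
  have hmem : QWeil.octic q a₁ a₂ a₃ a₄ ∈ QWeil.weilPolys q 4 ↔
      QWeil.CondA q a₁ ∧ QWeil.CondBStar q a₁ a₂ ∧ QWeil.CondB q a₁ a₂ ∧
        QWeil.CondC q a₁ a₂ a₃ ∧ QWeil.CondD q a₁ a₂ a₃ ∧ QWeil.CondE q a₁ a₂ a₃ a₄ ∧
        ∃ θ : Fin 3 → ℝ,
          QWeil.IsSorting
            (QWeil.cardano (QWeil.u₂ q a₁ a₂) (QWeil.u₃ q a₁ a₂ a₃) δ ζ ω) θ ∧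
          QWeil.CondG q a₁ a₂ a₃ a₄ (θ 0) (θ 1) := by
    rw [QWeil.octic_mem_weilPolys_iff]
    constructor
    · rintro ⟨x, hx, hb⟩
      obtain ⟨hA, hBs, hC, hE⟩ := (hbd hx).1 hb
      obtain ⟨hB, hD, hG⟩ := hrr.1 ⟨x, hx⟩
      exact ⟨hA, hBs, hB, hC, hD, hE, hG⟩
    · rintro ⟨hA, hBs, hB, hC, hD, hE, hG⟩
      obtain ⟨x, hx⟩ := hrr.2 ⟨hB, hD, hG⟩
      exact ⟨x, hx, (hbd hx).2 ⟨hA, hBs, hC, hE⟩⟩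
  refine ⟨fun hB => ?_, fun h => ?_, hmem, fun hh => ?_, QWeil.mem_and_hasRealRoot_iff, ?_⟩
  · rw [QWeil.radicandD_eq]
    linarith [QWeil.condB_iff.1 hB]
  · have hBD : QWeil.CondB q a₁ a₂ ∧ QWeil.CondD q a₁ a₂ a₃ := by
      rcases h with h | ⟨-, -, hB, -, hD⟩
      · obtain ⟨-, -, hB, -, hD, -⟩ := hmem.1 h
        exact ⟨hB, hD⟩
      · exact ⟨hB, hD⟩
    obtain ⟨g, hg, -⟩ := QWeil.exists_roots_of_cardano hδ ((QWeil.condD_iff hBD.1).1 hBD.2) hζ hω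
    exact fun k => ⟨_, hg k⟩
  · obtain ⟨x, hx, hb⟩ := QWeil.octic_mem_weilPolys_iff.1 hh
    rw [QWeil.hasRealRoot_octic_iff hx hb]
    have := QWeil.exists_root_at_endpoint_iff (by rwa [hq2]) hs hb (a₁ := a₁) (a₂ := a₂)
      (a₃ := a₃) (a₄ := a₄)
    rwa [hq2] at this
  · rintro ⟨⟨r, hr, -⟩, hns, -⟩
    exact hns ⟨r, by rw [← hr, sq]⟩
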